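/- Let $P\subseteq\mathbb R^3$ be a polyhedron (a finite union of solid tetrahedra) and let $b\in P$ be a beacon. A point located at $p\in P$, $p\neq b$, moves, while $b$ is enabled, with unit speed in a direction $v$ such that $p+\tau v\in P$ for all small $\tau\ge 0$, such that the distance to $b$ decreases along $v$, and such that no other such unit direction makes the distance to $b$ decrease more rapidly (ties may be broken arbitrarily); if there is no such direction, the point is stuck. We say that $b$ covers $p$ if there is a continuous path in $P$ from $p$ that has such a $v$ as its right derivative at every time before its end and that ends in $b$. For a finite set $B\subseteq P$, a point $p$ can be routed to $q$ via beacons from $B$ if there are $b_1,\dots,b_m\in B$ ($m\ge 0$) such that, with $b_0=p$ and $b_{m+1}=q$, the point $b_{i+1}$ covers $b_i$ for all $0\le i\le m$ (so the target $q$ acts as the last beacon and need not belong to $B$). Let $c\ge 1$ be an integer and $0<\delta<1$. Using polar coordinates $[\rho;\theta]$ in the plane $z=0$ of $\mathbb R^3$, put $$s=[1;0],\qquad t=\Big[\Big\lfloor\tfrac{c+1}{3}\Big\rfloor+1;\,(c+1)\tfrac{2\pi}{3}\Big],$$ $$q_k=\Big[\Big\lfloor\tfrac k3\Big\rfloor+1+\delta;\,k\tfrac{2\pi}{3}\Big],\qquad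 r_k=\Big[\Big\lfloor\tfrac k3\Big\rfloor+1;\,k\tfrac{2\pi}{3}\Big],\qquad z_k=r_k+(0,0,1)\qquad(1\le k\le c).$$ The $c$-corner spiral polyhedron $P$ is the union of the start and end tetrahedra $r_1q_1z_1s$ and $r_cq_cz_ct$ and, for each $1\le k<c$, of the three tetrahedra $r_kq_kz_kr_{k+1}$, $r_{k+1}q_{k+1}z_{k+1}q_k$ and $q_kz_kr_{k+1}z_{k+1}$. Then the listed vertices are $3c+2$ distinct points, the listed tetrahedra form a tetrahedral decomposition of $P$ (they are non-degenerate and have pairwise disjoint interiors) into $3c-1$ tetrahedra, and at least $c$ beacons are needed to route from $s$ to $t$: if $B\subseteq P$ is a finite set such that $s$ can be routed to $t$ via beacons from $B$, then $|B|\ge c$. -/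

import Mathlib

/-! ### Beacon attraction and beacon routing -/

namespace Beacon

section Attraction

variable {E : Type*} [NormedAddCommGroup E] [InnerProductSpace ℝ E]

/-- A point located at `p` can start moving in direction `v` without leaving `P`. -/
def Feasible (P : Set E) (p v : E) : Prop :=
  ∃ ε : ℝ, 0 < ε ∧ ∀ τ : ℝ, 0 ≤ τ → τ ≤ ε → p + τ • v ∈ P

/-- `v` is a unit direction in which a point of `P` located at `p` moves when the beacon `b` is
enabled: `v` is feasible, the distance to `b` decreases along `v`, and no other feasible unit
direction makes it decrease more rapidly. (The distance to `b` has derivative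
`- ⟪v, b - p⟫ / ‖b - p‖` at `p` in direction `v`.) The point is stuck if there is no such `v`. -/
structure GreedyDirection (P : Set E) (b p v : E) : Prop where
  norm_eq_one : ‖v‖ = 1
  feasible : Feasible P p v
  decreases : 0 < inner ℝ v (b - p)
  steepest : ∀ w : E, ‖w‖ = 1 → Feasible P p w → inner ℝ w (b - p) ≤ inner ℝ v (b - p)

/-- `γ`, restricted to `[0, T]`, is an attraction path in `P` from `p` that ends in the enabled
beacon `b`: it is continuous, stays in `P`, and at every time before `T` the point is moving
(right derivative) in a greedy direction, with unit speed. -/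
structure IsAttractionPath (P : Set E) (p b : E) (T : ℝ) (γ : ℝ → E) : Prop where
  nonneg : 0 ≤ T
  start : γ 0 = p
  finish : γ T = b
  continuousOn : ContinuousOn γ (Set.Icc 0 T)
  mem : ∀ t ∈ Set.Icc 0 T, γ t ∈ P
  greedy : ∀ t ∈ Set.Ico 0 T,
    ∃ v : E, GreedyDirection P b (γ t) v ∧ HasDerivWithinAt γ v (Set.Ici t) t

/-- The beacon `b` covers (attracts) the point `p` in `P`. -/
def Covers (P : Set E) (b p : E) : Prop :=
  ∃ (T : ℝ) (γ : ℝ → E), IsAttractionPath P p b T γ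

/-- `p` can be routed to `q` in `P` via beacons from `B`: there are `b₁, …, bₘ ∈ B` (possibly none)
such that `b₁` covers `p`, each `bᵢ₊₁` covers `bᵢ`, and `q`, enabled as the last beacon, covers
`bₘ` (covers `p` if `m = 0`). -/
def RoutableVia (P : Set E) (B : Set E) (p q : E) : Prop :=
  ∃ l : List E, (∀ b ∈ l, b ∈ B) ∧ List.IsChain (fun x y => Covers P y x) (p :: (l ++ [q]))

/-- `S` is a tetrahedral decomposition of `P`. A tetrahedron is given by its four vertices. -/
structure IsTetrahedralDecomposition (P : Set E) (S : Set (Fin 4 → E)) : Prop where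
  finite : S.Finite
  nondegenerate : ∀ σ ∈ S, AffineIndependent ℝ σ
  interiors_disjoint : S.Pairwise fun σ τ =>
    Disjoint (interior (convexHull ℝ (Set.range σ))) (interior (convexHull ℝ (Set.range τ)))
  union_eq : ⋃ σ ∈ S, convexHull ℝ (Set.range σ) = P

end Attraction

/-! ### The spiral polyhedron -/

noncomputable section

/-- The point of the `xy`-plane with polar coordinates `(ρ, θ)`. -/
def polar (ρ θ : ℝ) : EuclideanSpace ℝ (Fin 3) :=
  !₂[ρ * Real.cos θ, ρ * Real.sin θ, 0]

/-- The start point `s`. -/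
def spiralS : EuclideanSpace ℝ (Fin 3) := polar 1 0

/-- The end point `t` of the spiral with `c` corners. -/
def spiralT (c : ℕ) : EuclideanSpace ℝ (Fin 3) :=
  polar (((c + 1) / 3 : ℕ) + 1) ((c + 1) * (2 / 3 * Real.pi))

/-- The outer vertex `q_k`. -/
def spiralQ (δ : ℝ) (k : ℕ) : EuclideanSpace ℝ (Fin 3) :=
  polar ((k / 3 : ℕ) + 1 + δ) (k * (2 / 3 * Real.pi))

/-- The inner vertex `r_k`. -/
def spiralR (k : ℕ) : EuclideanSpace ℝ (Fin 3) :=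
  polar ((k / 3 : ℕ) + 1) (k * (2 / 3 * Real.pi))

/-- The vertex `z_k`, one unit above `r_k`. -/
def spiralZ (k : ℕ) : EuclideanSpace ℝ (Fin 3) :=
  spiralR k + !₂[0, 0, 1]

/-- The vertices of the spiral polyhedron. -/
def spiralVertices (c : ℕ) (δ : ℝ) : Set (EuclideanSpace ℝ (Fin 3)) :=
  {spiralS, spiralT c} ∪ ⋃ k ∈ Set.Icc 1 c, {spiralQ δ k, spiralR k, spiralZ k}

/-- The three tetrahedra of the hallway between corner `k` and corner `k + 1`. -/
def hallwayTetrahedra (δ : ℝ) (k : ℕ) : Set (Fin 4 → EuclideanSpace ℝ (Fin 3)) :=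
  {![spiralR k, spiralQ δ k, spiralZ k, spiralR (k + 1)],
   ![spiralR (k + 1), spiralQ δ (k + 1), spiralZ (k + 1), spiralQ δ k],
   ![spiralQ δ k, spiralZ k, spiralR (k + 1), spiralZ (k + 1)]}

/-- The tetrahedra of the spiral polyhedron: the start and end tetrahedra and the three tetrahedra
of each hallway. -/
def spiralTetrahedra (c : ℕ) (δ : ℝ) : Set (Fin 4 → EuclideanSpace ℝ (Fin 3)) :=
  {![spiralR 1, spiralQ δ 1, spiralZ 1, spiralS],
   ![spiralR c, spiralQ δ c, spiralZ c, spiralT c]} ∪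
  ⋃ k ∈ Set.Ico 1 c, hallwayTetrahedra δ k

/-- The `c`-corner spiral polyhedron of width `δ`, as a solid. -/
def spiralPolyhedron (c : ℕ) (δ : ℝ) : Set (EuclideanSpace ℝ (Fin 3)) :=
  ⋃ σ ∈ spiralTetrahedra c δ, convexHull ℝ (Set.range σ)

end

end Beacon

/-! Write `s = r_0` and `t = r_{c+1}`; hallway `j` joins corner `j` to corner `j + 1`, the start
tetrahedron is hallway `0` and the end tetrahedron is hallway `c`. In each hallway `j < c` a barrier
is placed shortly before corner `j + 1`: a plane orthogonal to `r_{j+1} - r_j`, or, in the start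
tetrahedron, a sphere about `s`. It separates the part `before` from the part `beyond`, so a route
from `s` to `t` crosses all `c` barriers.

Consider the last point `x` of an attraction path on a barrier. If the beacon `b` satisfied `⟪n, b -
x⟫ < 0` for the barrier normal `n`, then `-n` would decrease the distance to `b`. Since `-n` stays
in the convex hallway, perturbing the greedy direction towards `-n` shows that the greedy direction
itself goes back behind the barrier (`GreedyDirection.inner_pos`), a contradiction. Hence crossing
barrier `j` forces `Pulls c δ j b` (`Covers.pulls`), a condition on the position of `b` alone.

This condition fails for `b` in a sector congruent to `j + 2` modulo three
(`not_pulls_of_inSector`), and no `b` in sector `j + 1` satisfies it for both `j` and `j + 1`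
(`not_pulls_and_pulls`). So no beacon attracts across two barriers (`Covers.mem_before_succ`), and
`t` attracts across none. The `c` barriers therefore need `c` distinct members of `B`
(`card_beacons`).

The geometry is done in oblique coordinates along two consecutive corner directions. These
directions have period three, and one full turn adds one to the radius. Width `δ < 1` keeps
successive turns apart. -/

namespace Beacon

noncomputable section

/-! ### Oblique coordinates -/

/-- The distance of `r_k` from the origin. -/
def spiralRadius (k : ℕ) : ℝ := (k / 3 : ℕ) + 1

/-- The horizontal unit vector pointing towards the `k`-th corner. -/
def spiralDir (k : ℕ) : EuclideanSpace ℝ (Fin 3) := polar 1 (k * (2 / 3 * Real.pi))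

/-- The scalar product with `spiralDir k`. -/
def dirCoord (k : ℕ) : EuclideanSpace ℝ (Fin 3) →L[ℝ] ℝ := innerSL ℝ (spiralDir k)

/-- The first coordinate with respect to `spiralDir k`, `spiralDir (k + 1)` and the vertical unit
vector. -/
def coordA (k : ℕ) : EuclideanSpace ℝ (Fin 3) →L[ℝ] ℝ :=
  -- Dual basis: `spiralDir k - spiralDir (k + 2)` is orthogonal to `spiralDir (k + 1)` and has
  -- scalar product `3 / 2` with `spiralDir k`.
  (2 / 3 : ℝ) • (dirCoord k - dirCoord (k + 2))

/-- The second coordinate with respect to `spiralDir k`, `spiralDir (k + 1)` and the vertical unit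
vector. -/
def coordB (k : ℕ) : EuclideanSpace ℝ (Fin 3) →L[ℝ] ℝ :=
  (2 / 3 : ℝ) • (dirCoord (k + 1) - dirCoord (k + 2))

/-- The vertical coordinate. -/
def height : EuclideanSpace ℝ (Fin 3) →L[ℝ] ℝ := EuclideanSpace.proj 2

lemma height_apply (x : EuclideanSpace ℝ (Fin 3)) : height x = x 2 := rfl

lemma one_le_spiralRadius (k : ℕ) : 1 ≤ spiralRadius k := by
  simp [spiralRadius]

lemma spiralRadius_pos (k : ℕ) : 0 < spiralRadius k := one_pos.trans_le (one_le_spiralRadius k)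

lemma spiralRadius_mono : Monotone spiralRadius := fun i j h => by
  have : i / 3 ≤ j / 3 := Nat.div_le_div_right h
  simpa [spiralRadius] using this

lemma spiralRadius_add_three_mul (k m : ℕ) : spiralRadius (k + 3 * m) = spiralRadius k + m := by
  have : (k + 3 * m) / 3 = k / 3 + m := by omega
  simp [spiralRadius, this]; ring

lemma spiralRadius_succ_le (k : ℕ) : spiralRadius (k + 1) ≤ spiralRadius k + 1 := by
  have : (k + 1) / 3 ≤ k / 3 + 1 := by omega
  have : (((k + 1) / 3 : ℕ) : ℝ) ≤ (k / 3 : ℕ) + 1 := by exact_mod_cast this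
  simpa [spiralRadius] using this

lemma polar_eq_smul (ρ θ : ℝ) : polar ρ θ = ρ • polar 1 θ := by
  ext i; fin_cases i <;> simp [polar]

lemma spiralR_eq (k : ℕ) : spiralR k = spiralRadius k • spiralDir k := polar_eq_smul _ _

lemma spiralQ_eq (δ : ℝ) (k : ℕ) : spiralQ δ k = (spiralRadius k + δ) • spiralDir k :=
  polar_eq_smul _ _

lemma spiralS_eq : spiralS = spiralR 0 := by simp [spiralS, spiralR]

lemma spiralT_eq (c : ℕ) : spiralT c = spiralR (c + 1) := by simp [spiralT, spiralR]

lemma inner_polar (ρ θ : ℝ) (x : EuclideanSpace ℝ (Fin 3)) :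
    inner ℝ (polar ρ θ) x = ρ * (Real.cos θ * x 0 + Real.sin θ * x 1) := by
  simp [polar, PiLp.inner_apply, Fin.sum_univ_three]; ring

lemma cos_two_pi_div_three : Real.cos (2 / 3 * Real.pi) = -1 / 2 := by
  rw [show 2 / 3 * Real.pi = Real.pi - Real.pi / 3 by ring, Real.cos_pi_sub, Real.cos_pi_div_three]
  ring

lemma sin_two_pi_div_three : Real.sin (2 / 3 * Real.pi) = √3 / 2 := by
  rw [show 2 / 3 * Real.pi = Real.pi - Real.pi / 3 by ring, Real.sin_pi_sub, Real.sin_pi_div_three]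

lemma dirCoord_apply (k : ℕ) (x : EuclideanSpace ℝ (Fin 3)) :
    dirCoord k x = Real.cos (k * (2 / 3 * Real.pi)) * x 0 +
      Real.sin (k * (2 / 3 * Real.pi)) * x 1 := by
  simp [dirCoord, spiralDir, inner_polar]

/-- Three unit vectors at mutual angles of 120 degrees sum to zero. -/
lemma dirCoord_add_two (k : ℕ) (x : EuclideanSpace ℝ (Fin 3)) :
    dirCoord (k + 2) x = -dirCoord k x - dirCoord (k + 1) x := by
  have h3 : √3 ^ 2 = 3 := Real.sq_sqrt (by norm_num)
  have h1 : ((k + 1 : ℕ) : ℝ) * (2 / 3 * Real.pi) = k * (2 / 3 * Real.pi) + 2 / 3 * Real.pi := by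
    push_cast; ring
  have h2 : ((k + 2 : ℕ) : ℝ) * (2 / 3 * Real.pi) =
      k * (2 / 3 * Real.pi) + 2 / 3 * Real.pi + 2 / 3 * Real.pi := by
    push_cast; ring
  simp only [dirCoord_apply]
  rw [h2, h1]
  simp only [Real.cos_add, Real.sin_add, cos_two_pi_div_three, sin_two_pi_div_three]
  linear_combination (-Real.cos (k * (2 / 3 * Real.pi)) * x 0 -
    Real.sin (k * (2 / 3 * Real.pi)) * x 1) / 4 * h3

lemma coordA_apply (k : ℕ) (x : EuclideanSpace ℝ (Fin 3)) :
    coordA k x = 2 / 3 * (2 * dirCoord k x + dirCoord (k + 1) x) := by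
  simp [coordA, dirCoord_add_two]; ring

lemma coordB_apply (k : ℕ) (x : EuclideanSpace ℝ (Fin 3)) :
    coordB k x = 2 / 3 * (dirCoord k x + 2 * dirCoord (k + 1) x) := by
  simp [coordB, dirCoord_add_two]; ring

lemma dirCoord_eq (k : ℕ) (x : EuclideanSpace ℝ (Fin 3)) :
    dirCoord k x = coordA k x - coordB k x / 2 := by
  rw [coordA_apply, coordB_apply]; ring

lemma dirCoord_succ_eq (k : ℕ) (x : EuclideanSpace ℝ (Fin 3)) :
    dirCoord (k + 1) x = coordB k x - coordA k x / 2 := by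
  rw [coordA_apply, coordB_apply]; ring

/-- Change of frame: substitute `spiralDir k = -spiralDir (k + 1) - spiralDir (k + 2)`. With
`coordB_succ`, this lets neighbouring hallways be compared in one frame. -/
lemma coordA_succ (k : ℕ) (x : EuclideanSpace ℝ (Fin 3)) :
    coordA (k + 1) x = coordB k x - coordA k x := by
  rw [coordA_apply, coordA_apply, coordB_apply, show k + 1 + 1 = k + 2 from rfl, dirCoord_add_two]
  ring

lemma coordB_succ (k : ℕ) (x : EuclideanSpace ℝ (Fin 3)) :
    coordB (k + 1) x = -coordA k x := by
  rw [coordB_apply, coordA_apply, show k + 1 + 1 = k + 2 from rfl, dirCoord_add_two]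
  ring

lemma coordA_add_two (k : ℕ) (x : EuclideanSpace ℝ (Fin 3)) :
    coordA (k + 2) x = -coordB k x := by
  rw [coordA_succ, coordB_succ, coordA_succ]; ring

lemma coordB_add_two (k : ℕ) (x : EuclideanSpace ℝ (Fin 3)) :
    coordB (k + 2) x = coordA k x - coordB k x := by
  rw [coordB_succ, coordA_succ]; ring

lemma coordA_add_three_mul (k m : ℕ) (x : EuclideanSpace ℝ (Fin 3)) :
    coordA (k + 3 * m) x = coordA k x := by
  induction m with
  | zero => rfl
  | succ m ih =>
    rw [show k + 3 * (m + 1) = k + 3 * m + 1 + 2 by ring, coordA_add_two, coordB_succ, ih, neg_neg]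

lemma coordB_add_three_mul (k m : ℕ) (x : EuclideanSpace ℝ (Fin 3)) :
    coordB (k + 3 * m) x = coordB k x := by
  rw [← neg_inj, ← coordA_add_two, ← coordA_add_two,
    show k + 3 * m + 2 = k + 2 + 3 * m by ring, coordA_add_three_mul]

lemma dirCoord_spiralDir_self (k : ℕ) : dirCoord k (spiralDir k) = 1 := by
  rw [dirCoord_apply]
  simpa [spiralDir, polar, sq] using Real.cos_sq_add_sin_sq (k * (2 / 3 * Real.pi))

lemma dirCoord_succ_spiralDir (k : ℕ) : dirCoord (k + 1) (spiralDir k) = -1 / 2 := by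
  have h := Real.cos_sub (((k + 1 : ℕ) : ℝ) * (2 / 3 * Real.pi)) (k * (2 / 3 * Real.pi))
  rw [show ((k + 1 : ℕ) : ℝ) * (2 / 3 * Real.pi) - k * (2 / 3 * Real.pi) = 2 / 3 * Real.pi by
    push_cast; ring, cos_two_pi_div_three] at h
  rw [h, dirCoord_apply]
  simp [spiralDir, polar]

@[simp] lemma coordA_spiralDir (k : ℕ) : coordA k (spiralDir k) = 1 := by
  rw [coordA_apply, dirCoord_spiralDir_self, dirCoord_succ_spiralDir]; norm_num

@[simp] lemma coordB_spiralDir (k : ℕ) : coordB k (spiralDir k) = 0 := by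
  rw [coordB_apply, dirCoord_spiralDir_self, dirCoord_succ_spiralDir]; norm_num

@[simp] lemma coordA_spiralDir_succ (k : ℕ) : coordA k (spiralDir (k + 1)) = 0 := by
  rw [← neg_eq_zero, ← coordB_succ, coordB_spiralDir]

@[simp] lemma coordB_spiralDir_succ (k : ℕ) : coordB k (spiralDir (k + 1)) = 1 := by
  have := coordA_succ k (spiralDir (k + 1))
  simpa using this.symm

@[simp] lemma height_spiralDir (k : ℕ) : height (spiralDir k) = 0 := by
  simp [height, spiralDir, polar]

/-- The vertical unit vector. -/
def vertical : EuclideanSpace ℝ (Fin 3) := !₂[0, 0, 1]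

lemma spiralZ_eq (k : ℕ) : spiralZ k = spiralRadius k • spiralDir k + vertical := by
  rw [spiralZ, spiralR_eq, vertical]

@[simp] lemma dirCoord_vertical (k : ℕ) : dirCoord k vertical = 0 := by
  simp [dirCoord_apply, vertical]

@[simp] lemma coordA_vertical (k : ℕ) : coordA k vertical = 0 := by simp [coordA_apply]

@[simp] lemma coordB_vertical (k : ℕ) : coordB k vertical = 0 := by simp [coordB_apply]

@[simp] lemma height_vertical : height vertical = 1 := by simp [height, vertical]

/-- The coordinates determine the point. -/
lemma ext_coord (k : ℕ) {x y : EuclideanSpace ℝ (Fin 3)} (hA : coordA k x = coordA k y)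
    (hB : coordB k x = coordB k y) (hZ : height x = height y) : x = y := by
  have h0 : dirCoord k x = dirCoord k y := by rw [dirCoord_eq, dirCoord_eq, hA, hB]
  have h1 : dirCoord (k + 1) x = dirCoord (k + 1) y := by
    rw [dirCoord_succ_eq, dirCoord_succ_eq, hA, hB]
  rw [dirCoord_apply, dirCoord_apply] at h0
  rw [dirCoord_apply, dirCoord_apply, show ((k + 1 : ℕ) : ℝ) * (2 / 3 * Real.pi) =
    k * (2 / 3 * Real.pi) + 2 / 3 * Real.pi by push_cast; ring, Real.cos_add, Real.sin_add,
    cos_two_pi_div_three, sin_two_pi_div_three] at h1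
  have h3 : √3 ≠ 0 := by positivity
  set C := Real.cos (k * (2 / 3 * Real.pi))
  set S := Real.sin (k * (2 / 3 * Real.pi))
  have hCS : S ^ 2 + C ^ 2 = 1 := Real.sin_sq_add_cos_sq _
  have h2 : -S * x 0 + C * x 1 = -S * y 0 + C * y 1 := by
    apply mul_left_cancel₀ h3
    linear_combination 2 * h1 + h0
  ext i
  fin_cases i
  · change x 0 = y 0
    linear_combination C * h0 - S * h2 + (y 0 - x 0) * hCS
  · change x 1 = y 1
    linear_combination S * h0 + C * h2 + (y 1 - x 1) * hCS
  · exact hZ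

/-- Scalar products in oblique coordinates. -/
lemma inner_eq_coord (x y : EuclideanSpace ℝ (Fin 3)) :
    inner ℝ x y = coordA 0 x * coordA 0 y + coordB 0 x * coordB 0 y
      - (coordA 0 x * coordB 0 y + coordB 0 x * coordA 0 y) / 2 + height x * height y := by
  have h3 : √3 ^ 2 = 3 := Real.sq_sqrt (by norm_num)
  simp only [coordA_apply, coordB_apply, dirCoord_apply, height_apply,
    PiLp.inner_apply, Fin.sum_univ_three]
  simp [cos_two_pi_div_three, sin_two_pi_div_three]
  linear_combination (-x 1 * y 1 / 3) * h3

section Values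

variable (δ : ℝ) (k : ℕ)

@[simp] lemma coordA_spiralR : coordA k (spiralR k) = spiralRadius k := by simp [spiralR_eq]
@[simp] lemma coordB_spiralR : coordB k (spiralR k) = 0 := by simp [spiralR_eq]
@[simp] lemma height_spiralR : height (spiralR k) = 0 := by simp [spiralR_eq]
@[simp] lemma coordA_spiralR_succ : coordA k (spiralR (k + 1)) = 0 := by simp [spiralR_eq]
@[simp] lemma coordB_spiralR_succ : coordB k (spiralR (k + 1)) = spiralRadius (k + 1) := by
  simp [spiralR_eq]
@[simp] lemma coordA_spiralQ : coordA k (spiralQ δ k) = spiralRadius k + δ := by simp [spiralQ_eq]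
@[simp] lemma coordB_spiralQ : coordB k (spiralQ δ k) = 0 := by simp [spiralQ_eq]
@[simp] lemma height_spiralQ : height (spiralQ δ k) = 0 := by simp [spiralQ_eq]
@[simp] lemma coordA_spiralQ_succ : coordA k (spiralQ δ (k + 1)) = 0 := by simp [spiralQ_eq]
@[simp] lemma coordB_spiralQ_succ : coordB k (spiralQ δ (k + 1)) = spiralRadius (k + 1) + δ := by
  simp [spiralQ_eq]
@[simp] lemma coordA_spiralZ : coordA k (spiralZ k) = spiralRadius k := by simp [spiralZ_eq]
@[simp] lemma coordB_spiralZ : coordB k (spiralZ k) = 0 := by simp [spiralZ_eq]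
@[simp] lemma height_spiralZ : height (spiralZ k) = 1 := by simp [spiralZ_eq]
@[simp] lemma coordA_spiralZ_succ : coordA k (spiralZ (k + 1)) = 0 := by simp [spiralZ_eq]
@[simp] lemma coordB_spiralZ_succ : coordB k (spiralZ (k + 1)) = spiralRadius (k + 1) := by
  simp [spiralZ_eq]

end Values

/-! ### The vertices -/

lemma coordB_spiralDir_add_two (k : ℕ) : coordB k (spiralDir (k + 2)) = -1 := by
  have h' := coordA_add_two k (spiralDir (k + 2))
  simp only [coordA_spiralDir] at h'
  linarith

lemma spiralDir_add_three_mul (k m : ℕ) : spiralDir (k + 3 * m) = spiralDir k := by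
  refine ext_coord k ?_ ?_ (by simp)
  · rw [← coordA_add_three_mul k m]; simp
  · rw [← coordB_add_three_mul k m]; simp

lemma exists_eq_add_three_mul {i j : ℕ} (h : i ≤ j) :
    ∃ m, j = i + 3 * m ∨ j = i + 1 + 3 * m ∨ j = i + 2 + 3 * m :=
  ⟨(j - i) / 3, by omega⟩

/-- Only `j - i` modulo three matters for the direction; for residues one and two some oblique
coordinate would be both positive and nonpositive. -/
lemma smul_spiralDir_inj_of_le {i j : ℕ} (hij : i ≤ j) {ρ ρ' : ℝ} (hρ : 0 < ρ) (hρ' : 0 < ρ')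
    (h : ρ • spiralDir i = ρ' • spiralDir j) : i % 3 = j % 3 ∧ ρ = ρ' := by
  have hA := congrArg (coordA i) h
  have hB := congrArg (coordB i) h
  obtain ⟨m, rfl | rfl | rfl⟩ := exists_eq_add_three_mul hij
  · simp [spiralDir_add_three_mul] at hA
    exact ⟨by omega, hA⟩
  · simp [spiralDir_add_three_mul] at hA
    linarith
  · simp [spiralDir_add_three_mul, coordB_spiralDir_add_two] at hB
    linarith

lemma smul_spiralDir_inj {i j : ℕ} {ρ ρ' : ℝ} (hρ : 0 < ρ) (hρ' : 0 < ρ')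
    (h : ρ • spiralDir i = ρ' • spiralDir j) : i % 3 = j % 3 ∧ ρ = ρ' := by
  rcases le_total i j with hij | hij
  · exact smul_spiralDir_inj_of_le hij hρ hρ' h
  · obtain ⟨h1, h2⟩ := smul_spiralDir_inj_of_le hij hρ' hρ h.symm
    exact ⟨h1.symm, h2.symm⟩

lemma spiralR_injective : Function.Injective spiralR := fun i j h => by
  rw [spiralR_eq, spiralR_eq] at h
  obtain ⟨h1, h2⟩ := smul_spiralDir_inj (spiralRadius_pos i) (spiralRadius_pos j) h
  simp only [spiralRadius, add_left_inj, Nat.cast_inj] at h2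
  omega

lemma spiralZ_injective : Function.Injective spiralZ := fun _ _ h =>
  spiralR_injective (add_right_cancel h)

lemma spiralQ_injective {δ : ℝ} (hδ : 0 < δ) : Function.Injective (spiralQ δ) := fun i j h => by
  rw [spiralQ_eq, spiralQ_eq] at h
  obtain ⟨h1, h2⟩ := smul_spiralDir_inj (add_pos (spiralRadius_pos i) hδ)
    (add_pos (spiralRadius_pos j) hδ) h
  simp only [spiralRadius, add_left_inj, Nat.cast_inj] at h2
  omega

/-- The radii of the `r_i` are integers, those of the `q_j` lie strictly between consecutive
integers. -/
lemma spiralR_ne_spiralQ {δ : ℝ} (hδ₀ : 0 < δ) (hδ₁ : δ < 1) (i j : ℕ) :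
    spiralR i ≠ spiralQ δ j := fun h => by
  rw [spiralR_eq, spiralQ_eq] at h
  obtain ⟨-, h2⟩ := smul_spiralDir_inj (spiralRadius_pos i) (add_pos (spiralRadius_pos j) hδ₀) h
  simp only [spiralRadius] at h2
  have h3 : ((j / 3 : ℕ) : ℝ) < (i / 3 : ℕ) := by linarith
  have h4 : ((i / 3 : ℕ) : ℝ) < (j / 3 : ℕ) + 1 := by linarith
  norm_cast at h3 h4
  omega

lemma spiralVertices_eq (c : ℕ) (hc : 1 ≤ c) (δ : ℝ) :
    spiralVertices c δ =
      spiralR '' Set.Icc 0 (c + 1) ∪ (spiralQ δ '' Set.Icc 1 c ∪ spiralZ '' Set.Icc 1 c) := by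
  ext x
  simp only [spiralVertices, spiralS_eq, spiralT_eq, Set.mem_union, Set.mem_insert_iff,
    Set.mem_singleton_iff, Set.mem_iUnion, Set.mem_image, Set.mem_Icc, exists_prop]
  constructor
  · rintro ((rfl | rfl) | ⟨k, hk, rfl | rfl | rfl⟩)
    · exact .inl ⟨0, by omega, rfl⟩
    · exact .inl ⟨c + 1, by omega, rfl⟩
    · exact .inr (.inl ⟨k, hk, rfl⟩)
    · exact .inl ⟨k, by omega, rfl⟩
    · exact .inr (.inr ⟨k, hk, rfl⟩)
  · rintro (⟨k, hk, rfl⟩ | ⟨k, hk, rfl⟩ | ⟨k, hk, rfl⟩)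
    · rcases Nat.eq_zero_or_pos k with rfl | h0
      · exact .inl (.inl rfl)
      · rcases hk.2.eq_or_lt with rfl | h1
        · exact .inl (.inr rfl)
        · exact .inr ⟨k, by omega, .inr (.inl rfl)⟩
    · exact .inr ⟨k, hk, .inl rfl⟩
    · exact .inr ⟨k, hk, .inr (.inr rfl)⟩

lemma ncard_spiralVertices (c : ℕ) (hc : 1 ≤ c) {δ : ℝ} (hδ₀ : 0 < δ) (hδ₁ : δ < 1) :
    (spiralVertices c δ).ncard = 3 * c + 2 := by
  have hfin (a b : ℕ) (f : ℕ → EuclideanSpace ℝ (Fin 3)) : (f '' Set.Icc a b).Finite :=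
    (Set.finite_Icc a b).image f
  have hcard (a b : ℕ) : (Set.Icc a b).ncard = b + 1 - a := by
    rw [← Nat.card_Icc, ← Finset.coe_Icc, Set.ncard_coe_finset]
  rw [spiralVertices_eq c hc, Set.ncard_union_eq _ (hfin _ _ _) ((hfin _ _ _).union (hfin _ _ _)),
    Set.ncard_union_eq _ (hfin _ _ _) (hfin _ _ _),
    Set.ncard_image_of_injective _ spiralR_injective,
    Set.ncard_image_of_injective _ (spiralQ_injective hδ₀),
    Set.ncard_image_of_injective _ spiralZ_injective, hcard, hcard]
  · omega
  · rw [Set.disjoint_left]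
    rintro _ ⟨i, -, rfl⟩ ⟨j, -, h⟩
    simpa using congrArg height h
  · rw [Set.disjoint_left]
    rintro _ ⟨i, -, rfl⟩ (⟨j, -, h⟩ | ⟨j, -, h⟩)
    · exact spiralR_ne_spiralQ hδ₀ hδ₁ i j h.symm
    · simpa using congrArg height h

/-! ### The tetrahedra -/

/-- The tetrahedra of the spiral polyhedron, indexed by hallway (hallway `0` is the start
tetrahedron, hallway `c` consists of the end tetrahedron only) and by their position in it. -/
def spiralTet (δ : ℝ) (j : ℕ) (i : Fin 3) : Fin 4 → EuclideanSpace ℝ (Fin 3) :=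
  if j = 0 then ![spiralR 1, spiralQ δ 1, spiralZ 1, spiralR 0] else
  ![![spiralR j, spiralQ δ j, spiralZ j, spiralR (j + 1)],
    ![spiralR (j + 1), spiralQ δ (j + 1), spiralZ (j + 1), spiralQ δ j],
    ![spiralQ δ j, spiralZ j, spiralR (j + 1), spiralZ (j + 1)]] i

/-- The positions of the tetrahedra in hallway `j`. -/
def hallIndex (c j : ℕ) : Finset (Fin 3) := if j = 0 ∨ j = c then {0} else Finset.univ

/-- The indices of the tetrahedra of the spiral polyhedron. -/
def spiralIndex (c : ℕ) : Finset (Σ _ : ℕ, Fin 3) := (Finset.range (c + 1)).sigma (hallIndex c)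

lemma spiralTetrahedra_eq (c : ℕ) (hc : 1 ≤ c) (δ : ℝ) :
    spiralTetrahedra c δ = (fun p : Σ _ : ℕ, Fin 3 => spiralTet δ p.1 p.2) '' spiralIndex c := by
  ext σ
  simp only [spiralTetrahedra, hallwayTetrahedra, spiralIndex, spiralS_eq, spiralT_eq,
    Set.mem_union, Set.mem_insert_iff, Set.mem_singleton_iff, Set.mem_iUnion, Set.mem_image,
    Set.mem_Ico, exists_prop, Finset.coe_sigma, Set.mem_sigma_iff, Finset.coe_range, Set.mem_Iio,
    Finset.mem_coe, Sigma.exists]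
  constructor
  · rintro ((rfl | rfl) | ⟨k, hk, rfl | rfl | rfl⟩)
    · exact ⟨0, 0, ⟨by omega, by simp [hallIndex]⟩, by simp [spiralTet]⟩
    · have hc0 : c ≠ 0 := by omega
      exact ⟨c, 0, ⟨by omega, by simp [hallIndex]⟩, by simp [spiralTet, hc0]⟩
    · have hk0 : k ≠ 0 := by omega
      exact ⟨k, 0, ⟨by omega, by simp [hallIndex, hk0, hk.2.ne]⟩, by simp [spiralTet, hk0]⟩
    · have hk0 : k ≠ 0 := by omega
      exact ⟨k, 1, ⟨by omega, by simp [hallIndex, hk0, hk.2.ne]⟩, by simp [spiralTet, hk0]⟩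
    · have hk0 : k ≠ 0 := by omega
      exact ⟨k, 2, ⟨by omega, by simp [hallIndex, hk0, hk.2.ne]⟩, by simp [spiralTet, hk0]⟩
  · rintro ⟨k, i, ⟨hk, hi⟩, rfl⟩
    by_cases h0 : k = 0
    · subst h0; simp [spiralTet]
    by_cases h1 : k = c
    · subst h1
      simp only [hallIndex, or_true, if_true, Finset.mem_singleton] at hi
      subst hi
      exact .inl (.inr (by simp [spiralTet, h0]))
    · refine .inr ⟨k, by omega, ?_⟩
      fin_cases i <;> simp [spiralTet, h0]

lemma card_spiralIndex (c : ℕ) (hc : 1 ≤ c) : (spiralIndex c).card = 3 * c - 1 := by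
  obtain ⟨c, rfl⟩ := Nat.exists_eq_add_of_le' hc
  rw [spiralIndex, Finset.card_sigma, Finset.sum_range_succ, Finset.sum_range_succ']
  rw [Finset.sum_congr rfl (g := fun _ => 3)]
  · simp [hallIndex]; omega
  · intro k hk
    have : k ≠ c := (Finset.mem_range.1 hk).ne
    simp [hallIndex, this]

/-- The linear function that takes the value one on `ρ • spiralDir j` and on
`ρ' • spiralDir (j + 1)`. -/
def gauge (j : ℕ) (ρ ρ' : ℝ) : EuclideanSpace ℝ (Fin 3) →L[ℝ] ℝ :=
  ρ⁻¹ • coordA j + ρ'⁻¹ • coordB j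

lemma gauge_apply (j : ℕ) (ρ ρ' : ℝ) (x : EuclideanSpace ℝ (Fin 3)) :
    gauge j ρ ρ' x = coordA j x / ρ + coordB j x / ρ' := by
  simp [gauge, div_eq_inv_mul]

/-- A convex set containing hallway `j` and the corresponding part of the hallways around it. -/
structure InSector (δ : ℝ) (j : ℕ) (x : EuclideanSpace ℝ (Fin 3)) : Prop where
  coordA_nonneg : 0 ≤ coordA j x
  coordB_nonneg : 0 ≤ coordB j x
  height_nonneg : 0 ≤ height x
  height_le : height x ≤ 1
  inner_wall : 1 ≤ gauge j (spiralRadius j) (spiralRadius (j + 1)) x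
  outer_wall : gauge j (spiralRadius j + δ) (spiralRadius (j + 1) + δ) x ≤ 1

lemma convex_setOf_le (f : EuclideanSpace ℝ (Fin 3) →L[ℝ] ℝ) (r : ℝ) : Convex ℝ {x | f x ≤ r} :=
  convex_halfSpace_le f.toLinearMap.isLinear r

lemma convex_setOf_ge (f : EuclideanSpace ℝ (Fin 3) →L[ℝ] ℝ) (r : ℝ) : Convex ℝ {x | r ≤ f x} :=
  convex_halfSpace_ge f.toLinearMap.isLinear r

lemma convex_inSector (δ : ℝ) (j : ℕ) : Convex ℝ {x | InSector δ j x} := by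
  have h := (convex_setOf_ge (coordA j) 0).inter <| (convex_setOf_ge (coordB j) 0).inter <|
    (convex_setOf_ge height 0).inter <| (convex_setOf_le height 1).inter <|
    (convex_setOf_ge (gauge j (spiralRadius j) (spiralRadius (j + 1))) 1).inter <|
    convex_setOf_le (gauge j (spiralRadius j + δ) (spiralRadius (j + 1) + δ)) 1
  convert h using 1
  ext x
  exact ⟨fun ⟨h1, h2, h3, h4, h5, h6⟩ => ⟨h1, h2, h3, h4, h5, h6⟩,
    fun ⟨h1, h2, h3, h4, h5, h6⟩ => ⟨h1, h2, h3, h4, h5, h6⟩⟩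

lemma inSector_spiralTet {δ : ℝ} (hδ : 0 < δ) (j : ℕ) (i : Fin 3) (m : Fin 4) :
    InSector δ j (spiralTet δ j i m) := by
  have h0 := spiralRadius_pos j
  have h1 := spiralRadius_pos (j + 1)
  have h0' : 0 < spiralRadius j + δ := by positivity
  have h1' : 0 < spiralRadius (j + 1) + δ := by positivity
  have hr : InSector δ j (spiralR j) := by
    refine ⟨?_, ?_, ?_, ?_, ?_, ?_⟩ <;> simp [gauge_apply, h0.le, h0.ne', div_le_one h0', hδ.le]
  have hq : InSector δ j (spiralQ δ j) := by
    refine ⟨?_, ?_, ?_, ?_, ?_, ?_⟩ <;> simp [gauge_apply, h0'.le, h0'.ne', one_le_div h0, hδ.le]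
  have hz : InSector δ j (spiralZ j) := by
    refine ⟨?_, ?_, ?_, ?_, ?_, ?_⟩ <;> simp [gauge_apply, h0.le, h0.ne', div_le_one h0', hδ.le]
  have hr' : InSector δ j (spiralR (j + 1)) := by
    refine ⟨?_, ?_, ?_, ?_, ?_, ?_⟩ <;> simp [gauge_apply, h1.le, h1.ne', div_le_one h1', hδ.le]
  have hq' : InSector δ j (spiralQ δ (j + 1)) := by
    refine ⟨?_, ?_, ?_, ?_, ?_, ?_⟩ <;> simp [gauge_apply, h1'.le, h1'.ne', one_le_div h1, hδ.le]
  have hz' : InSector δ j (spiralZ (j + 1)) := by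
    refine ⟨?_, ?_, ?_, ?_, ?_, ?_⟩ <;> simp [gauge_apply, h1.le, h1.ne', div_le_one h1', hδ.le]
  by_cases hj : j = 0
  · subst hj
    rw [spiralTet, if_pos rfl]
    fin_cases m <;> assumption
  · rw [spiralTet, if_neg hj]
    fin_cases i <;> fin_cases m <;> assumption

lemma InSector.spiralRadius_le {δ : ℝ} {j : ℕ} {x : EuclideanSpace ℝ (Fin 3)}
    (h : InSector δ j x) (hB : coordB j x = 0) : spiralRadius j ≤ coordA j x := by
  have := h.inner_wall
  rwa [gauge_apply, hB, zero_div, add_zero, one_le_div (spiralRadius_pos j)] at this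

lemma InSector.spiralRadius_succ_le {δ : ℝ} {j : ℕ} {x : EuclideanSpace ℝ (Fin 3)}
    (h : InSector δ j x) (hA : coordA j x = 0) : spiralRadius (j + 1) ≤ coordB j x := by
  have := h.inner_wall
  rwa [gauge_apply, hA, zero_div, zero_add, one_le_div (spiralRadius_pos _)] at this

lemma InSector.le_spiralRadius_add {δ : ℝ} (hδ : 0 < δ) {j : ℕ} {x : EuclideanSpace ℝ (Fin 3)}
    (h : InSector δ j x) (hB : coordB j x = 0) : coordA j x ≤ spiralRadius j + δ := by
  have := h.outer_wall
  rwa [gauge_apply, hB, zero_div, add_zero,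
    div_le_one (add_pos (spiralRadius_pos j) hδ)] at this

lemma InSector.le_spiralRadius_succ_add {δ : ℝ} (hδ : 0 < δ) {j : ℕ}
    {x : EuclideanSpace ℝ (Fin 3)}
    (h : InSector δ j x) (hA : coordA j x = 0) : coordB j x ≤ spiralRadius (j + 1) + δ := by
  have := h.outer_wall
  rwa [gauge_apply, hA, zero_div, zero_add,
    div_le_one (add_pos (spiralRadius_pos _) hδ)] at this

/-- Further turns of the spiral lie outside of the outer wall. -/
lemma InSector.one_lt_gauge {δ : ℝ} (hδ₀ : 0 < δ) (hδ₁ : δ < 1) {j m : ℕ} (hm : m ≠ 0)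
    {x : EuclideanSpace ℝ (Fin 3)} (h : InSector δ (j + 3 * m) x) :
    1 < gauge j (spiralRadius j + δ) (spiralRadius (j + 1) + δ) x := by
  have hA := h.coordA_nonneg
  have hB := h.coordB_nonneg
  have hG := h.inner_wall
  have hm' : (1 : ℝ) ≤ m := by exact_mod_cast Nat.one_le_iff_ne_zero.2 hm
  have h0 := spiralRadius_pos j
  have h1 := spiralRadius_pos (j + 1)
  rw [show j + 3 * m + 1 = j + 1 + 3 * m by ring, gauge_apply, spiralRadius_add_three_mul,
    spiralRadius_add_three_mul, coordA_add_three_mul, coordB_add_three_mul] at hG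
  rw [coordA_add_three_mul] at hA
  rw [coordB_add_three_mul] at hB
  rw [gauge_apply]
  rcases hA.eq_or_lt with hA0 | hA0
  · rcases hB.eq_or_lt with hB0 | hB0
    · simp [← hA0, ← hB0] at hG
      linarith
    · rw [← hA0, zero_div, zero_add] at hG
      rw [← hA0, zero_div, zero_add]
      refine hG.trans_lt ?_
      gcongr
      linarith
  -- The later inner wall has radii larger by `m ≥ 1 > δ`, so both quotients grow when the
  -- denominators are replaced; strictness comes from the positive coordinate.
  · refine hG.trans_lt (add_lt_add_of_lt_of_le ?_ ?_)
    · gcongr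
      linarith
    · gcongr
      linarith

/-- Hallways meet only if they are consecutive. -/
lemma InSector.eq_succ_of_lt {δ : ℝ} (hδ₀ : 0 < δ) (hδ₁ : δ < 1) {i j : ℕ} (hij : i < j)
    {x : EuclideanSpace ℝ (Fin 3)} (hi : InSector δ i x) (hj : InSector δ j x) :
    j = i + 1 ∧ coordA i x = 0 := by
  -- Residue zero: an outer wall separates two turns. Residues one and two: the sectors share only a
  -- vertical half-plane through the axis, where comparing radii leaves `m = 0` for residue one and
  -- nothing for residue two.
  obtain ⟨m, rfl | rfl | rfl⟩ := exists_eq_add_three_mul hij.le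
  · have h := hj.one_lt_gauge hδ₀ hδ₁ (by omega)
    exact absurd hi.outer_wall h.not_ge
  · have hB := hj.coordB_nonneg
    rw [coordB_add_three_mul, coordB_succ] at hB
    have hA : coordA i x = 0 := le_antisymm (by linarith) hi.coordA_nonneg
    refine ⟨?_, hA⟩
    by_contra hm
    have hm' : (1 : ℝ) ≤ m := by exact_mod_cast (by omega : 1 ≤ m)
    have h1 := hi.le_spiralRadius_succ_add hδ₀ hA
    have h2 := hj.spiralRadius_le (by rw [coordB_add_three_mul, coordB_succ, hA, neg_zero])
    rw [spiralRadius_add_three_mul, coordA_add_three_mul, coordA_succ, hA] at h2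
    linarith
  · have hA := hj.coordA_nonneg
    rw [coordA_add_three_mul, coordA_add_two] at hA
    have hB : coordB i x = 0 := le_antisymm (by linarith) hi.coordB_nonneg
    have h1 := hi.le_spiralRadius_add hδ₀ hB
    have h2 := hj.spiralRadius_succ_le
      (by rw [coordA_add_three_mul, coordA_add_two, hB, neg_zero])
    rw [show i + 2 + 3 * m + 1 = i + 3 * (m + 1) by ring, spiralRadius_add_three_mul,
      coordB_add_three_mul, coordB_add_two, hB] at h2
    push_cast at h2
    have : (0 : ℝ) ≤ m := m.cast_nonneg
    linarith

/-! ### The tetrahedral decomposition -/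

lemma affineIndependent_fin_four {V : Type*} [AddCommGroup V] [Module ℝ V] {p : Fin 4 → V}
    (h : ∀ w : Fin 4 → ℝ, w 0 + w 1 + w 2 + w 3 = 0 →
      w 0 • p 0 + w 1 • p 1 + w 2 • p 2 + w 3 • p 3 = 0 → ∀ i, w i = 0) :
    AffineIndependent ℝ p := by
  rw [affineIndependent_iff]
  intro s w hw hp i hi
  have := h (fun i => if i ∈ s then w i else 0) ?_ ?_ i
  · simpa [hi] using this
  · have h1 := Finset.sum_ite_mem Finset.univ s w
    rwa [Finset.univ_inter, hw, Fin.sum_univ_four] at h1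
  · have h1 := Finset.sum_ite_mem Finset.univ s (fun e => w e • p e)
    rw [Finset.univ_inter, hp, Fin.sum_univ_four] at h1
    simpa only [ite_smul, zero_smul] using h1

lemma affineIndependent_spiralTet {δ : ℝ} (hδ : 0 < δ) (j : ℕ) (i : Fin 3) :
    AffineIndependent ℝ (spiralTet δ j i) := by
  have h0 := spiralRadius_pos j
  have h1 := spiralRadius_pos (j + 1)
  refine affineIndependent_fin_four fun w hw hp => ?_
  have hA := congrArg (coordA j) hp
  have hB := congrArg (coordB j) hp
  have hZ := congrArg height hp
  by_cases hj : j = 0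
  · subst hj
    simp only [spiralTet, if_true, Matrix.cons_val, map_add, map_smul, smul_eq_mul, map_zero] at hA hB hZ
    simp only [zero_add] at h1
    have e1 := coordA_spiralR_succ 0
    have e2 := coordB_spiralR_succ 0
    have e3 := coordA_spiralQ_succ δ 0
    have e4 := coordB_spiralQ_succ δ 0
    have e5 := coordA_spiralZ_succ 0
    have e6 := coordB_spiralZ_succ 0
    simp only [zero_add] at e1 e2 e3 e4 e5 e6
    simp [e1, e2, e3, e4, e5, e6, h0.ne'] at hA hB hZ
    have w1 : w 1 = 0 := by
      rw [hA, hZ] at hw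
      have : w 1 * δ = 0 := by
        rw [hZ] at hB
        linear_combination hB - spiralRadius 1 * hw
      simpa [hδ.ne'] using this
    intro i
    fin_cases i <;> simp <;> linarith
  · simp only [spiralTet, if_neg hj] at hA hB hZ
    fin_cases i
    · simp [h1.ne'] at hA hB hZ
      have w1 : w 1 = 0 := by
        have : w 1 * δ = 0 := by
          rw [hZ] at hA
          rw [hB, hZ] at hw
          linear_combination hA - spiralRadius j * hw
        simpa [hδ.ne'] using this
      intro i
      fin_cases i <;> simp <;> linarith
    · simp [(add_pos h0 hδ).ne'] at hA hB hZ
      have w1 : w 1 = 0 := by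
        have : w 1 * δ = 0 := by
          rw [hZ] at hB
          rw [hA, hZ] at hw
          linear_combination hB - spiralRadius (j + 1) * hw
        simpa [hδ.ne'] using this
      intro i
      fin_cases i <;> simp <;> linarith
    · simp at hA hB hZ
      have w23 : w 2 + w 3 = 0 := by
        have : (w 2 + w 3) * spiralRadius (j + 1) = 0 := by linear_combination hB
        simpa [h1.ne'] using this
      have w0 : w 0 = 0 := by
        have : w 0 * δ = 0 := by
          linear_combination hA - spiralRadius j * hw + spiralRadius j * w23
        simpa [hδ.ne'] using this
      intro i
      fin_cases i <;> simp <;> linarith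

/-- A common interior point would give a nonempty open set on which `f` is constantly `r`, but a
nonzero functional is an open map. -/
lemma disjoint_interior_of_separated {f : EuclideanSpace ℝ (Fin 3) →L[ℝ] ℝ} (hf : f ≠ 0) {r : ℝ}
    {σ τ : Fin 4 → EuclideanSpace ℝ (Fin 3)} (hσ : ∀ i, f (σ i) ≤ r) (hτ : ∀ i, r ≤ f (τ i)) :
    Disjoint (interior (convexHull ℝ (Set.range σ))) (interior (convexHull ℝ (Set.range τ))) := by
  have h1 : convexHull ℝ (Set.range σ) ⊆ {x | f x ≤ r} :=
    convexHull_min (Set.range_subset_iff.2 hσ) (convex_setOf_le f r)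
  have h2 : convexHull ℝ (Set.range τ) ⊆ {x | r ≤ f x} :=
    convexHull_min (Set.range_subset_iff.2 hτ) (convex_setOf_ge f r)
  rw [Set.disjoint_iff_inter_eq_empty, ← interior_inter]
  by_contra hne
  obtain ⟨x, hx⟩ := Set.nonempty_iff_ne_empty.2 hne
  have hsub : f '' interior (convexHull ℝ (Set.range σ) ∩ convexHull ℝ (Set.range τ)) ⊆ {r} := by
    rintro _ ⟨y, hy, rfl⟩
    exact le_antisymm (h1 (interior_subset hy).1) (h2 (interior_subset hy).2)
  have hopen := f.isOpenMap_of_ne_zero hf _ (isOpen_interior (s :=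
    convexHull ℝ (Set.range σ) ∩ convexHull ℝ (Set.range τ)))
  have := interior_maximal hsub hopen ⟨x, hx, rfl⟩
  simp at this

/-- The separating plane is the outer wall of sector `j`, the plane `coordA j = 0` or the plane
`coordB j = 0`, according to `j' - j` modulo three. -/
lemma disjoint_interior_of_lt {δ : ℝ} (hδ₀ : 0 < δ) (hδ₁ : δ < 1) {j j' : ℕ} (h : j < j')
    (i i' : Fin 3) :
    Disjoint (interior (convexHull ℝ (Set.range (spiralTet δ j i))))
      (interior (convexHull ℝ (Set.range (spiralTet δ j' i')))) := by
  have hj := inSector_spiralTet hδ₀ j i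
  have hj' := inSector_spiralTet hδ₀ j' i'
  obtain ⟨m, rfl | rfl | rfl⟩ := exists_eq_add_three_mul h.le
  · refine disjoint_interior_of_separated
      (f := gauge j (spiralRadius j + δ) (spiralRadius (j + 1) + δ)) (r := 1) (fun h0 => ?_)
      (fun n => (hj n).outer_wall) (fun n => ((hj' n).one_lt_gauge hδ₀ hδ₁ (by omega)).le)
    have h1 := DFunLike.congr_fun h0 (spiralDir j)
    simp [gauge_apply] at h1
    have := spiralRadius_pos j
    linarith
  · refine (disjoint_interior_of_separated (f := coordA j) (r := 0) (fun h0 => ?_)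
      (fun n => ?_) (fun n => (hj n).coordA_nonneg)).symm
    · simpa using DFunLike.congr_fun h0 (spiralDir j)
    · have := (hj' n).coordB_nonneg
      rw [coordB_add_three_mul, coordB_succ] at this
      linarith
  · refine (disjoint_interior_of_separated (f := coordB j) (r := 0) (fun h0 => ?_)
      (fun n => ?_) (fun n => (hj n).coordB_nonneg)).symm
    · simpa using DFunLike.congr_fun h0 (spiralDir (j + 1))
    · have := (hj' n).coordA_nonneg
      rw [coordA_add_three_mul, coordA_add_two] at this
      linarith

/-- The vertical plane through `q_j` and `r_{j+1}` has tetrahedra `0` and `2` on one side and `1` on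
the other; `0` and `2` are separated by the plane of their common face `q_j z_j r_{j+1}`, which the
`height` term tilts. -/
lemma disjoint_interior_of_ne {δ : ℝ} (hδ : 0 < δ) {j : ℕ} (hj : j ≠ 0) {i i' : Fin 3}
    (h : i ≠ i') :
    Disjoint (interior (convexHull ℝ (Set.range (spiralTet δ j i))))
      (interior (convexHull ℝ (Set.range (spiralTet δ j i')))) := by
  have h0 := spiralRadius_pos j
  have h1 := spiralRadius_pos (j + 1)
  have h0' : 0 < spiralRadius j + δ := by positivity
  have h1' : 0 < spiralRadius (j + 1) + δ := by positivity
  have e1 : spiralRadius j / (spiralRadius j + δ) + δ / (spiralRadius j + δ) = 1 := by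
    field_simp
  have e2 : spiralRadius j / (spiralRadius j + δ) ≤ 1 := by rw [div_le_one h0']; linarith
  have e3 : 1 ≤ (spiralRadius (j + 1) + δ) / spiralRadius (j + 1) := by
    rw [one_le_div h1]; linarith
  have e4 : 0 ≤ δ / (spiralRadius j + δ) := by positivity
  have hne (f : EuclideanSpace ℝ (Fin 3) →L[ℝ] ℝ) (hf : f (spiralQ δ j) = 1) : f ≠ 0 := by
    rintro rfl
    simp at hf
  have key (n n' : Fin 3) (hlt : n < n') :
      Disjoint (interior (convexHull ℝ (Set.range (spiralTet δ j n))))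
        (interior (convexHull ℝ (Set.range (spiralTet δ j n')))) := by
    fin_cases n <;> fin_cases n' <;> try exact absurd hlt (by decide)
    · refine disjoint_interior_of_separated (f := gauge j (spiralRadius j + δ) (spiralRadius (j + 1)))
        (r := 1) (hne _ ?_) (fun n => ?_) (fun n => ?_)
      · simp [gauge_apply, h0'.ne']
      · fin_cases n <;> simp [spiralTet, hj, gauge_apply, h0'.ne', h1.ne', e2]
      · fin_cases n <;> simp [spiralTet, hj, gauge_apply, h0'.ne', h1.ne', e3]
    · refine disjoint_interior_of_separated (f := gauge j (spiralRadius j + δ) (spiralRadius (j + 1))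
        + (δ / (spiralRadius j + δ)) • height) (r := 1) (hne _ ?_) (fun n => ?_) (fun n => ?_)
      · simp [gauge_apply, h0'.ne']
      · fin_cases n <;> simp [spiralTet, hj, gauge_apply, h0'.ne', h1.ne', e1, e2]
      · fin_cases n <;> simp [spiralTet, hj, gauge_apply, h0'.ne', h1.ne', e1, e4]
    · refine (disjoint_interior_of_separated (f := gauge j (spiralRadius j + δ) (spiralRadius (j + 1)))
        (r := 1) (hne _ ?_) (fun n => ?_) (fun n => ?_)).symm
      · simp [gauge_apply, h0'.ne']
      · fin_cases n <;> simp [spiralTet, hj, gauge_apply, h0'.ne', h1.ne', e2]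
      · fin_cases n <;> simp [spiralTet, hj, gauge_apply, h0'.ne', h1.ne', e3]
  rcases h.lt_or_gt with hlt | hlt
  · exact key _ _ hlt
  · exact (key _ _ hlt).symm

lemma pairwise_disjoint_interior {δ : ℝ} (hδ₀ : 0 < δ) (hδ₁ : δ < 1) (c : ℕ)
    {p q : Σ _ : ℕ, Fin 3} (hp : p ∈ spiralIndex c) (hq : q ∈ spiralIndex c) (hpq : p ≠ q) :
    Disjoint (interior (convexHull ℝ (Set.range (spiralTet δ p.1 p.2))))
      (interior (convexHull ℝ (Set.range (spiralTet δ q.1 q.2)))) := by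
  obtain ⟨j, i⟩ := p
  obtain ⟨j', i'⟩ := q
  rcases lt_trichotomy j j' with h | rfl | h
  · exact disjoint_interior_of_lt hδ₀ hδ₁ h i i'
  · have hi : i ≠ i' := fun h => hpq (by rw [h])
    refine disjoint_interior_of_ne hδ₀ (fun h0 => ?_) hi
    have hp' := (Finset.mem_sigma.1 hp).2
    have hq' := (Finset.mem_sigma.1 hq).2
    subst h0
    simp only [hallIndex, true_or, if_true, Finset.mem_singleton] at hp' hq'
    exact hi (hp'.trans hq'.symm)
  · exact (disjoint_interior_of_lt hδ₀ hδ₁ h i' i).symm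

lemma interior_spiralTet_nonempty {δ : ℝ} (hδ : 0 < δ) (j : ℕ) (i : Fin 3) :
    (interior (convexHull ℝ (Set.range (spiralTet δ j i)))).Nonempty := by
  rw [interior_convexHull_nonempty_iff_affineSpan_eq_top]
  refine (affineIndependent_spiralTet hδ j i).affineSpan_eq_top_iff_card_eq_finrank_add_one.2 ?_
  simp

lemma isTetrahedralDecomposition_spiralPolyhedron (c : ℕ) (hc : 1 ≤ c) {δ : ℝ} (hδ₀ : 0 < δ)
    (hδ₁ : δ < 1) : IsTetrahedralDecomposition (spiralPolyhedron c δ) (spiralTetrahedra c δ) where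
  finite := by
    rw [spiralTetrahedra_eq c hc]
    exact (Finset.finite_toSet _).image _
  nondegenerate := by
    rw [spiralTetrahedra_eq c hc]
    rintro _ ⟨p, -, rfl⟩
    exact affineIndependent_spiralTet hδ₀ _ _
  interiors_disjoint := by
    rw [spiralTetrahedra_eq c hc]
    rintro _ ⟨p, hp, rfl⟩ _ ⟨q, hq, rfl⟩ h
    exact pairwise_disjoint_interior hδ₀ hδ₁ c hp hq fun hpq => h (by rw [hpq])
  union_eq := rfl

/-- Different indices give disjoint interiors, and the interiors are nonempty, so the tetrahedra are
different. -/
lemma ncard_spiralTetrahedra (c : ℕ) (hc : 1 ≤ c) {δ : ℝ} (hδ₀ : 0 < δ) (hδ₁ : δ < 1) :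
    (spiralTetrahedra c δ).ncard = 3 * c - 1 := by
  rw [spiralTetrahedra_eq c hc, Set.InjOn.ncard_image, Set.ncard_coe_finset,
    card_spiralIndex c hc]
  intro p hp q hq h
  by_contra hpq
  have hd := pairwise_disjoint_interior hδ₀ hδ₁ c hp hq hpq
  have h' : spiralTet δ p.1 p.2 = spiralTet δ q.1 q.2 := h
  rw [h', disjoint_self, Set.bot_eq_empty] at hd
  exact (interior_spiralTet_nonempty hδ₀ q.1 q.2).ne_empty hd

/-! ### Attraction paths and barriers -/

section Attraction

variable {E : Type*} [NormedAddCommGroup E] [InnerProductSpace ℝ E]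

lemma Feasible.of_eventually {P H : Set E} {x v : E} (h : Feasible P x v)
    (hH : ∀ᶠ y in nhds x, y ∈ P → y ∈ H) : Feasible H x v := by
  obtain ⟨ε, hε, hP⟩ := h
  have hcont : Filter.Tendsto (fun τ : ℝ => x + τ • v) (nhds 0) (nhds x) := by
    have : Continuous fun τ : ℝ => x + τ • v := by fun_prop
    simpa using this.tendsto 0
  obtain ⟨η, hη, hball⟩ := Metric.eventually_nhds_iff.1 (hcont.eventually hH)
  refine ⟨min ε (η / 2), by positivity, fun τ h0 h1 => hball ?_ (hP τ h0 ?_)⟩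
  · rw [Real.dist_eq, sub_zero, abs_of_nonneg h0]
    linarith [h1.trans (min_le_right _ _)]
  · exact h1.trans (min_le_left _ _)

lemma Feasible.add_smul {H : Set E} (hH : Convex ℝ H) {x v d : E} (hv : Feasible H x v) {ε : ℝ}
    (hε : 0 < ε) (hd : x + ε • d ∈ H) {s : ℝ} (hs : 0 < s) : Feasible H x (v + s • d) := by
  obtain ⟨η, hη, hP⟩ := hv
  have hx : x ∈ H := by simpa using hP 0 le_rfl hη.le
  refine ⟨min (η / 2) (ε / (2 * s)), by positivity, fun τ h0 h1 => ?_⟩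
  have h2 : 2 * τ ≤ η := by linarith [h1.trans (min_le_left _ _)]
  have h3 : τ * (2 * s) ≤ ε := (le_div_iff₀ (by positivity)).1 (h1.trans (min_le_right _ _))
  have hd' : x + (2 * τ * s) • d ∈ H := by
    have := hH.add_smul_mem hx hd (t := 2 * τ * s / ε)
      ⟨by positivity, (div_le_one hε).2 (by linarith)⟩
    rwa [smul_smul, div_mul_cancel₀ _ hε.ne'] at this
  -- `x + τ • (v + s • d)` is the midpoint of `x + (2 * τ) • v` and `x + (2 * τ * s) • d`, both in
  -- `H`.
  convert hH (hP (2 * τ) (by positivity) h2) hd' (a := 1 / 2) (b := 1 / 2) (by norm_num)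
    (by norm_num) (by norm_num) using 1
  module

/-- A greedy direction that is tangent to a convex part `H` of `P` cannot point away from a
direction `d` that stays in `H` and decreases the distance to the beacon. -/
lemma GreedyDirection.inner_pos {P H : Set E} {b x v d : E} (hv : GreedyDirection P b x v)
    (hHP : H ⊆ P) (hH : Convex ℝ H) (hfeas : Feasible H x v) {ε : ℝ} (hε : 0 < ε)
    (hd : x + ε • d ∈ H) (hb : 0 < inner ℝ d (b - x)) : 0 < inner ℝ d v := by
  by_contra! hdv
  set A := inner ℝ v (b - x) with hA
  set e := inner ℝ d (b - x) with he
  have hA0 : 0 < A := hv.decreases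
  set D := ‖d‖ ^ 2 with hD
  have hD0 : 0 ≤ D := by positivity
  -- Compare `v` with the normalised `v + s • d`. If `⟪d, v⟫ ≤ 0`, the norm grows only to second
  -- order in `s`, while the scalar product with `b - x` gains `s * e`; this `s` is small enough for
  -- the gain to win.
  set s := e / (A * (D + 1)) with hs
  have hs0 : 0 < s := by positivity
  have hsA : s * A * (D + 1) = e := by
    rw [hs]; field_simp
  obtain ⟨η, hη, hP⟩ := hfeas.add_smul hH hε hd hs0
  have hw : inner ℝ (v + s • d) (b - x) = A + s * e := by
    rw [inner_add_left, real_inner_smul_left]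
  have hN2 : ‖v + s • d‖ ^ 2 ≤ 1 + s ^ 2 * D := by
    rw [norm_add_sq_real, hv.norm_eq_one, real_inner_smul_right, norm_smul, Real.norm_eq_abs,
      mul_pow, sq_abs, real_inner_comm]
    nlinarith
  set N := ‖v + s • d‖ with hN
  have hN0 : 0 < N := by
    rw [hN, norm_pos_iff]
    intro h0
    rw [h0, inner_zero_left] at hw
    nlinarith [mul_pos hs0 hb]
  have hle := hv.steepest (N⁻¹ • (v + s • d)) (by
    rw [norm_smul, norm_inv, norm_norm, inv_mul_cancel₀ hN0.ne']) ⟨η * N, by positivity,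
      fun τ h0 h1 => hHP (by
        rw [smul_smul]
        refine hP _ (by positivity) ?_
        rwa [← div_eq_mul_inv, div_le_iff₀ hN0])⟩
  rw [real_inner_smul_left, hw, inv_mul_le_iff₀ hN0] at hle
  have h1 : (A + s * e) ^ 2 ≤ (N * A) ^ 2 := by
    have : 0 ≤ A + s * e := by positivity
    gcongr
  have h2 : (N * A) ^ 2 ≤ (1 + s ^ 2 * D) * A ^ 2 := by
    rw [mul_pow]; gcongr
  have h3 : s * A * (2 * e) ≤ s * A * (s * A * D) := by nlinarith [sq_nonneg (s * e)]
  have h4 := le_of_mul_le_mul_left h3 (by positivity)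
  nlinarith [mul_pos hs0 hA0]

/-- The last time at which an attraction path leaves a closed set. -/
lemma IsAttractionPath.exists_last {P L U : Set E} {p b : E} {T : ℝ} {γ : ℝ → E}
    (h : IsAttractionPath P p b T γ) (hL : IsClosed L) (hU : IsClosed U) (hP : P ⊆ L ∪ U)
    (hp : p ∈ L) (hb : b ∉ L) :
    ∃ t₀ ∈ Set.Ico 0 T, γ t₀ ∈ L ∧ γ t₀ ∈ U ∧ ∀ t ∈ Set.Ioc t₀ T, γ t ∉ L := by
  set S := Set.Icc 0 T ∩ γ ⁻¹' L with hS
  have hclosed : IsClosed S := h.continuousOn.preimage_isClosed_of_isClosed isClosed_Icc hL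
  have hcompact : IsCompact S := isCompact_Icc.of_isClosed_subset hclosed Set.inter_subset_left
  have hne : S.Nonempty := ⟨0, ⟨le_rfl, h.nonneg⟩, by simpa [h.start] using hp⟩
  have hmem := hcompact.sSup_mem hne
  set t₀ := sSup S
  have hlt : t₀ < T := hmem.1.2.lt_of_ne fun h0 => hb (by rw [← h.finish, ← h0]; exact hmem.2)
  have hlast : ∀ t ∈ Set.Ioc t₀ T, γ t ∉ L := fun t ht htL =>
    (le_csSup hcompact.bddAbove ⟨⟨hmem.1.1.trans ht.1.le, ht.2⟩, htL⟩).not_gt ht.1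
  refine ⟨t₀, ⟨hmem.1.1, hlt⟩, hmem.2, ?_, hlast⟩
  have htend : Filter.Tendsto γ (nhdsWithin t₀ (Set.Ioc t₀ T)) (nhds (γ t₀)) :=
    (h.continuousOn t₀ hmem.1).mono_left
      (nhdsWithin_mono _ fun t ht => ⟨hmem.1.1.trans ht.1.le, ht.2⟩)
  have : (nhdsWithin t₀ (Set.Ioc t₀ T)).NeBot := by
    rw [nhdsWithin_Ioc_eq_nhdsGT hlt]; infer_instance
  refine hU.mem_of_tendsto htend ?_
  filter_upwards [self_mem_nhdsWithin] with t ht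
  exact (hP (h.mem t ⟨hmem.1.1.trans ht.1.le, ht.2⟩)).resolve_left (hlast t ht)

end Attraction

lemma nonneg_of_hasDerivWithinAt_Ici {g : ℝ → ℝ} {g' t₀ : ℝ}
    (hg : HasDerivWithinAt g g' (Set.Ici t₀) t₀) (h : ∀ᶠ t in nhdsWithin t₀ (Set.Ioi t₀), g t₀ ≤ g t) :
    0 ≤ g' := by
  have := hasDerivWithinAt_iff_tendsto_slope.1 hg
  rw [Set.Ici_sdiff_left] at this
  refine ge_of_tendsto this ?_
  filter_upwards [h, self_mem_nhdsWithin] with t ht ht'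
  rw [slope_def_field]
  exact div_nonneg (sub_nonneg.2 ht) (sub_nonneg.2 (le_of_lt ht'))

/-! ### Hallways -/

/-- The hallway `j`. -/
def hall (c : ℕ) (δ : ℝ) (j : ℕ) : Set (EuclideanSpace ℝ (Fin 3)) :=
  ⋃ i ∈ hallIndex c j, convexHull ℝ (Set.range (spiralTet δ j i))

lemma mem_spiralPolyhedron {c : ℕ} (hc : 1 ≤ c) {δ : ℝ} {x : EuclideanSpace ℝ (Fin 3)} :
    x ∈ spiralPolyhedron c δ ↔ ∃ j ≤ c, x ∈ hall c δ j := by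
  simp only [spiralPolyhedron, spiralTetrahedra_eq c hc, Set.mem_iUnion, Set.mem_image, hall,
    spiralIndex, Finset.coe_sigma, Set.mem_sigma_iff, Sigma.exists, exists_prop, Finset.mem_coe,
    Finset.mem_range, Nat.lt_succ_iff]
  constructor
  · rintro ⟨_, ⟨j, i, ⟨hj, hi⟩, rfl⟩, hx⟩
    exact ⟨j, hj, i, hi, hx⟩
  · rintro ⟨j, hj, i, hi, hx⟩
    exact ⟨_, ⟨j, i, ⟨hj, hi⟩, rfl⟩, hx⟩

lemma isClosed_hall (c : ℕ) (δ : ℝ) (j : ℕ) : IsClosed (hall c δ j) :=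
  (Finset.finite_toSet _).isClosed_biUnion fun _ _ =>
    ((Set.finite_range _).isCompact_convexHull ℝ).isClosed

lemma inSector_of_mem_hall {c : ℕ} {δ : ℝ} (hδ : 0 < δ) {j : ℕ} {x : EuclideanSpace ℝ (Fin 3)}
    (hx : x ∈ hall c δ j) : InSector δ j x := by
  simp only [hall, Set.mem_iUnion] at hx
  obtain ⟨i, -, hx⟩ := hx
  exact convexHull_min (Set.range_subset_iff.2 (inSector_spiralTet hδ j i)) (convex_inSector δ j) hx

lemma hall_zero (c : ℕ) (δ : ℝ) : hall c δ 0 = convexHull ℝ (Set.range (spiralTet δ 0 0)) := by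
  simp [hall, hallIndex]

/-- The wall of the start tetrahedron opposite to `r_1`. -/
lemma start_wall {c : ℕ} {δ : ℝ} (hδ : 0 < δ) {x : EuclideanSpace ℝ (Fin 3)}
    (hx : x ∈ hall c δ 0) : (1 + δ) * coordA 0 x + coordB 0 x + δ * height x ≤ 1 + δ := by
  rw [hall_zero] at hx
  refine convexHull_min (Set.range_subset_iff.2 fun m => ?_)
    (convex_setOf_le ((1 + δ) • coordA 0 + coordB 0 + δ • height) (1 + δ)) hx
  have e1 := coordA_spiralR_succ 0
  have e2 := coordB_spiralR_succ 0
  have e3 := coordA_spiralQ_succ δ 0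
  have e4 := coordB_spiralQ_succ δ 0
  have e5 := coordA_spiralZ_succ 0
  have e6 := coordB_spiralZ_succ 0
  simp only [zero_add] at e1 e2 e3 e4 e5 e6
  have e7 : spiralRadius 0 = 1 := by simp [spiralRadius]
  have e8 : spiralRadius 1 = 1 := by simp [spiralRadius]
  fin_cases m <;> simp [spiralTet, e1, e2, e3, e4, e5, e6, e7, e8, hδ.le]

/-- The inequalities defining a hallway. -/
structure InHall (δ : ℝ) (j : ℕ) (x : EuclideanSpace ℝ (Fin 3)) : Prop where
  coordA_nonneg : 0 ≤ coordA j x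
  coordB_nonneg : 0 ≤ coordB j x
  height_nonneg : 0 ≤ height x
  inner_wall : 1 ≤ gauge j (spiralRadius j) (spiralRadius (j + 1)) x
  upper_wall : gauge j (spiralRadius j) (spiralRadius (j + 1)) x + δ / spiralRadius j * height x ≤
    1 + δ / spiralRadius j
  outer_wall : gauge j (spiralRadius j + δ) (spiralRadius (j + 1) + δ) x +
    δ / (spiralRadius (j + 1) + δ) * height x ≤ 1

lemma convex_inHall (δ : ℝ) (j : ℕ) : Convex ℝ {x | InHall δ j x} := by
  have h := (convex_setOf_ge (coordA j) 0).inter <| (convex_setOf_ge (coordB j) 0).inter <|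
    (convex_setOf_ge height 0).inter <|
    (convex_setOf_ge (gauge j (spiralRadius j) (spiralRadius (j + 1))) 1).inter <|
    (convex_setOf_le (gauge j (spiralRadius j) (spiralRadius (j + 1)) +
      (δ / spiralRadius j) • height) (1 + δ / spiralRadius j)).inter <|
    convex_setOf_le (gauge j (spiralRadius j + δ) (spiralRadius (j + 1) + δ) +
      (δ / (spiralRadius (j + 1) + δ)) • height) 1
  convert h using 1
  ext x
  exact ⟨fun ⟨h1, h2, h3, h4, h5, h6⟩ => ⟨h1, h2, h3, h4, h5, h6⟩,
    fun ⟨h1, h2, h3, h4, h5, h6⟩ => ⟨h1, h2, h3, h4, h5, h6⟩⟩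

/-- The upper wall is the plane `q_j z_j z_{j+1}`, the outer wall the plane `q_j q_{j+1} z_{j+1}`.
Monotonicity of the radii puts `q_{j+1}` and `z_j` on the inner side of them, which is why the three
tetrahedra have a convex union. -/
lemma inHall_spiralTet {δ : ℝ} (hδ : 0 < δ) {j : ℕ} (hj : j ≠ 0) (i : Fin 3) (m : Fin 4) :
    InHall δ j (spiralTet δ j i m) := by
  have hs := inSector_spiralTet hδ j i m
  have h0 := spiralRadius_pos j
  have h1 := spiralRadius_pos (j + 1)
  have h01 := spiralRadius_mono j.le_succ
  have h0' : 0 < spiralRadius j + δ := by positivity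
  have h1' : 0 < spiralRadius (j + 1) + δ := by positivity
  have e0 : 0 ≤ δ / spiralRadius j := by positivity
  have e1 : (spiralRadius j + δ) / spiralRadius j = 1 + δ / spiralRadius j := by field_simp
  have e2 : (spiralRadius (j + 1) + δ) / spiralRadius (j + 1) ≤ 1 + δ / spiralRadius j := by
    rw [add_div, div_self h1.ne']
    gcongr
  have e3 : spiralRadius (j + 1) / (spiralRadius (j + 1) + δ) + δ / (spiralRadius (j + 1) + δ) = 1 := by
    field_simp
  have e4 : spiralRadius j / (spiralRadius j + δ) + δ / (spiralRadius (j + 1) + δ) ≤ 1 := by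
    rw [← e3, add_le_add_iff_right, div_le_div_iff₀ h0' h1']
    nlinarith
  have e5 : spiralRadius j / (spiralRadius j + δ) ≤ 1 := by rw [div_le_one h0']; linarith
  have e6 : spiralRadius (j + 1) / (spiralRadius (j + 1) + δ) ≤ 1 := by
    rw [div_le_one h1']; linarith
  refine ⟨hs.coordA_nonneg, hs.coordB_nonneg, hs.height_nonneg, hs.inner_wall, ?_, ?_⟩
  · fin_cases i <;> fin_cases m <;>
      simp [spiralTet, hj, gauge_apply, h0.ne', h1.ne', e0, e1, e2]
  · fin_cases i <;> fin_cases m <;>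
      simp [spiralTet, hj, gauge_apply, h0'.ne', h1'.ne', e3, e4, e5, e6]

lemma mem_convexHull_of_weights {σ : Fin 4 → EuclideanSpace ℝ (Fin 3)} (w₀ w₁ w₂ w₃ : ℝ)
    (h₀ : 0 ≤ w₀) (h₁ : 0 ≤ w₁) (h₂ : 0 ≤ w₂) (h₃ : 0 ≤ w₃) (hw : w₀ + w₁ + w₂ + w₃ = 1) :
    w₀ • σ 0 + w₁ • σ 1 + w₂ • σ 2 + w₃ • σ 3 ∈ convexHull ℝ (Set.range σ) := by
  have := (convex_convexHull ℝ (Set.range σ)).sum_mem (t := Finset.univ) (w := ![w₀, w₁, w₂, w₃])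
    (z := σ) (fun i _ => by fin_cases i <;> assumption) (by simpa [Fin.sum_univ_four] using hw)
    (fun i _ => subset_convexHull ℝ _ ⟨i, rfl⟩)
  simpa [Fin.sum_univ_four] using this

/-- The separating planes of `disjoint_interior_of_ne` tell which tetrahedron contains `x`; the
weights are its barycentric coordinates, and the hallway inequalities make them nonnegative. -/
lemma exists_mem_of_inHall {δ : ℝ} (hδ : 0 < δ) {j : ℕ} (hj : j ≠ 0)
    {x : EuclideanSpace ℝ (Fin 3)} (h : InHall δ j x) :
    ∃ i, x ∈ convexHull ℝ (Set.range (spiralTet δ j i)) := by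
  obtain ⟨hA, hB, hZ, hI, hU, hO⟩ := h
  rw [gauge_apply] at hI hU hO
  have h0 := spiralRadius_pos j
  have h1 := spiralRadius_pos (j + 1)
  set a := spiralRadius j with ha
  set a' := spiralRadius (j + 1) with ha'
  have h0' : 0 < a + δ := by positivity
  have h1' : 0 < a' + δ := by positivity
  set A := coordA j x with hAx
  set B := coordB j x with hBx
  set Z := height x with hZx
  have hβ : B / a' * a' = B := div_mul_cancel₀ _ h1.ne'
  have hα : A / (a + δ) * (a + δ) = A := div_mul_cancel₀ _ h0'.ne'
  have hα₁ : A / a * a = A := div_mul_cancel₀ _ h0.ne'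
  set β := B / a' with hβdef
  set α := A / (a + δ) with hαdef
  have hβ0 : 0 ≤ β := by positivity
  have hα0 : 0 ≤ α := by positivity
  -- weight of `q_j` in the first and in the last tetrahedron
  set κ := (A / a + β - 1) * (a / δ) with hκ
  have hκ0 : 0 ≤ κ := mul_nonneg (by linarith) (by positivity)
  have hκδ : κ * δ = A - a * (1 - β) := by
    rw [hκ, mul_assoc, div_mul_cancel₀ _ hδ.ne']
    linear_combination hα₁
  have hκα : κ * δ = (a + δ) * (α + β - 1) + δ * (1 - β) := by
    rw [hκδ]; linear_combination -hα
  have hκZ : κ + Z ≤ 1 := by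
    have hd : δ / a * a = δ := div_mul_cancel₀ _ h0.ne'
    have : (κ + Z) * δ ≤ 1 * δ := by
      have := mul_le_mul_of_nonneg_right hU h0.le
      have e : (A / a + β + δ / a * Z) * a = A + β * a + δ * Z := by
        linear_combination hα₁ + Z * hd
      have e' : (1 + δ / a) * a = a + δ := by linear_combination hd
      rw [e, e'] at this
      linarith
    exact le_of_mul_le_mul_right this hδ
  by_cases hαβ : α + β ≤ 1
  · have hκβ : κ ≤ 1 - β := by
      refine le_of_mul_le_mul_right ?_ hδ
      nlinarith
    by_cases hs : β + Z + κ ≤ 1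
    · refine ⟨0, ?_⟩
      have := mem_convexHull_of_weights (σ := spiralTet δ j 0) (1 - κ - Z - β) κ Z β
        (by linarith) hκ0 hZ hβ0 (by ring)
      convert this using 1
      refine ext_coord j ?_ ?_ ?_
      · simp [spiralTet, hj, ← ha, ← hAx]
        linear_combination -hκδ
      · simp [spiralTet, hj, ← ha', ← hBx]
        linear_combination -hβ
      · simp [spiralTet, hj, ← hZx]
    · refine ⟨2, ?_⟩
      have := mem_convexHull_of_weights (σ := spiralTet δ j 2) κ (1 - β - κ) (1 - Z - κ)
        (Z + β + κ - 1) hκ0 (by linarith) (by linarith) (by linarith) (by ring)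
      convert this using 1
      refine ext_coord j ?_ ?_ ?_
      · simp [spiralTet, hj, ← ha, ← hAx]
        linear_combination -hκδ
      · simp [spiralTet, hj, ← ha', ← hBx]
        linear_combination -hβ
      · simp [spiralTet, hj, ← hZx]
        ring
  · refine ⟨1, ?_⟩
    set μ := (β + α - 1) * (a' / δ) with hμ
    have hμ0 : 0 ≤ μ := mul_nonneg (by linarith) (by positivity)
    have hμδ : μ * δ = B - a' * (1 - α) := by
      rw [hμ, mul_assoc, div_mul_cancel₀ _ hδ.ne']
      linear_combination hβ
    have hsum : μ + Z + α ≤ 1 := by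
      have hd : B / (a' + δ) * (a' + δ) = B := div_mul_cancel₀ _ h1'.ne'
      have hd' : δ / (a' + δ) * (a' + δ) = δ := div_mul_cancel₀ _ h1'.ne'
      have := mul_le_mul_of_nonneg_right hO h1'.le
      have e : (α + B / (a' + δ) + δ / (a' + δ) * Z) * (a' + δ) = α * (a' + δ) + B + δ * Z := by
        linear_combination hd + Z * hd'
      rw [e] at this
      refine le_of_mul_le_mul_right (a := δ) ?_ hδ
      linarith
    have := mem_convexHull_of_weights (σ := spiralTet δ j 1) (1 - μ - Z - α) μ Z α
      (by linarith) hμ0 hZ hα0 (by ring)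
    convert this using 1
    refine ext_coord j ?_ ?_ ?_
    · simp [spiralTet, hj, ← ha, ← hAx]
      linear_combination -hα
    · simp [spiralTet, hj, ← ha', ← hBx]
      linear_combination -hμδ
    · simp [spiralTet, hj, ← hZx]

lemma hall_eq {c : ℕ} {δ : ℝ} (hδ : 0 < δ) {j : ℕ} (hj : j ≠ 0) (hjc : j < c) :
    hall c δ j = {x | InHall δ j x} := by
  ext x
  simp only [hall, hallIndex, hj, hjc.ne, or_self, if_false, Finset.mem_univ, Set.iUnion_true,
    Set.mem_iUnion, Set.mem_ofPred_eq]
  refine ⟨fun ⟨i, hx⟩ => ?_, exists_mem_of_inHall hδ hj⟩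
  exact convexHull_min (Set.range_subset_iff.2 (inHall_spiralTet hδ hj i)) (convex_inHall δ j) hx

lemma convex_hall {c : ℕ} {δ : ℝ} (hδ : 0 < δ) {j : ℕ} (hjc : j < c) :
    Convex ℝ (hall c δ j) := by
  rcases eq_or_ne j 0 with rfl | hj
  · rw [hall_zero]; exact convex_convexHull _ _
  · rw [hall_eq hδ hj hjc]; exact convex_inHall δ j

/-! ### The barriers -/

/-- The gradient of `barrier j`. -/
def barrierNormal (j : ℕ) (x : EuclideanSpace ℝ (Fin 3)) : EuclideanSpace ℝ (Fin 3) :=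
  if j = 0 then x - spiralR 0 else spiralR (j + 1) - spiralR j

/-- A function that measures the progress in hallway `j`. -/
def barrier (j : ℕ) (x : EuclideanSpace ℝ (Fin 3)) : ℝ :=
  if j = 0 then ‖x - spiralR 0‖ ^ 2 / 2 else inner ℝ (spiralR (j + 1) - spiralR j) x

/-- The value of `barrier j` at a surface shortly before the corner `j + 1`. -/
def barrierLevel (j : ℕ) : ℝ :=
  -- At `r_{j+1}` the barrier function equals `3 / 2` for `j = 0` and the bracket below otherwise;
  -- the levels lie slightly under that. A sphere is used for `j = 0` because the start tetrahedron
  -- tapers to `s`, and moving towards `s` stays inside by convexity.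
  if j = 0 then 29 / 20 else
    9 / 10 * (spiralRadius (j + 1) * (spiralRadius (j + 1) + spiralRadius j / 2))

lemma hasFDerivAt_barrier (j : ℕ) (x : EuclideanSpace ℝ (Fin 3)) :
    HasFDerivAt (barrier j) (innerSL ℝ (barrierNormal j x)) x := by
  by_cases hj : j = 0
  · have h := (((hasFDerivAt_id x).sub_const (spiralR 0)).norm_sq).const_mul (1 / 2)
    have e : barrier j = fun y => 1 / 2 * ‖id y - spiralR 0‖ ^ 2 := by
      ext y; simp [barrier, hj]; ring
    rw [e]
    refine h.congr_fderiv ?_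
    ext y
    simp [barrierNormal, hj]
  · have e : barrier j = innerSL ℝ (spiralR (j + 1) - spiralR j) := by
      ext y; rw [barrier, if_neg hj, innerSL_apply_apply]
    rw [e, barrierNormal, if_neg hj]
    exact ContinuousLinearMap.hasFDerivAt _

lemma continuous_barrier (j : ℕ) : Continuous (barrier j) :=
  continuous_iff_continuousAt.2 fun x => (hasFDerivAt_barrier j x).continuousAt

lemma barrierLevel_pos (j : ℕ) : 0 < barrierLevel j := by
  have h0 := spiralRadius_pos j
  have h1 := spiralRadius_pos (j + 1)
  rw [barrierLevel]
  split_ifs <;> positivity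

lemma inner_spiralR (k : ℕ) (x : EuclideanSpace ℝ (Fin 3)) :
    inner ℝ (spiralR k) x = spiralRadius k * dirCoord k x := by
  rw [spiralR_eq, real_inner_smul_left, dirCoord, innerSL_apply_apply]

lemma inner_spiralR_sub (j : ℕ) (x : EuclideanSpace ℝ (Fin 3)) :
    inner ℝ (spiralR (j + 1) - spiralR j) x =
      coordB j x * (spiralRadius (j + 1) + spiralRadius j / 2) -
      coordA j x * (spiralRadius (j + 1) / 2 + spiralRadius j) := by
  rw [inner_sub_left, inner_spiralR, inner_spiralR, dirCoord_succ_eq, dirCoord_eq]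
  ring

lemma spiralRadius_zero : spiralRadius 0 = 1 := by simp [spiralRadius]
lemma spiralRadius_one : spiralRadius 1 = 1 := by simp [spiralRadius]
lemma spiralRadius_two : spiralRadius 2 = 1 := by simp [spiralRadius]

lemma barrier_zero (x : EuclideanSpace ℝ (Fin 3)) :
    barrier 0 x = ((coordA 0 x - 1) ^ 2 + coordB 0 x ^ 2 - (coordA 0 x - 1) * coordB 0 x
      + height x ^ 2) / 2 := by
  rw [barrier, if_pos rfl, ← real_inner_self_eq_norm_sq, inner_eq_coord]
  simp [spiralRadius_zero]
  ring

/-- With `barrier_lt_level`, this keeps the barrier off the faces shared with neighbouring hallways,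
so that near it the polyhedron is a single convex hallway. -/
lemma level_lt_barrier {c : ℕ} {δ : ℝ} (hδ : 0 < δ) {j : ℕ} {x : EuclideanSpace ℝ (Fin 3)}
    (hx : x ∈ hall c δ j) (hA : coordA j x = 0) : barrierLevel j < barrier j x := by
  have hs := inSector_of_mem_hall hδ hx
  have hB := hs.spiralRadius_succ_le hA
  by_cases hj : j = 0
  · subst hj
    rw [zero_add, spiralRadius_one] at hB
    rw [barrier_zero, hA, barrierLevel, if_pos rfl]
    nlinarith [sq_nonneg (height x)]
  · have h0 := spiralRadius_pos j
    have h1 := spiralRadius_pos (j + 1)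
    rw [barrier, if_neg hj, inner_spiralR_sub, hA, barrierLevel, if_neg hj]
    have h2 : spiralRadius (j + 1) * (spiralRadius (j + 1) + spiralRadius j / 2) ≤
        coordB j x * (spiralRadius (j + 1) + spiralRadius j / 2) := by gcongr
    have h3 : 0 < spiralRadius (j + 1) * (spiralRadius (j + 1) + spiralRadius j / 2) := by
      positivity
    linarith

lemma barrier_lt_level {δ : ℝ} {j : ℕ} (hj : j ≠ 0) {x : EuclideanSpace ℝ (Fin 3)}
    (hx : InSector δ j x) (hB : coordB j x = 0) : barrier j x < barrierLevel j := by
  have h0 := spiralRadius_pos j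
  have h1 := spiralRadius_pos (j + 1)
  have := barrierLevel_pos j
  have hA := hx.coordA_nonneg
  rw [barrier, if_neg hj, inner_spiralR_sub, hB]
  have : 0 ≤ coordA j x * (spiralRadius (j + 1) / 2 + spiralRadius j) := by positivity
  linarith

/-- The part of the spiral before the barrier in hallway `j`. -/
def before (c : ℕ) (δ : ℝ) (j : ℕ) : Set (EuclideanSpace ℝ (Fin 3)) :=
  (⋃ i ∈ Set.Iio j, hall c δ i) ∪ (hall c δ j ∩ {x | barrier j x ≤ barrierLevel j})

/-- The part of the spiral from the barrier in hallway `j` on. -/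
def beyond (c : ℕ) (δ : ℝ) (j : ℕ) : Set (EuclideanSpace ℝ (Fin 3)) :=
  (⋃ i ∈ Set.Ioc j c, hall c δ i) ∪ (hall c δ j ∩ {x | barrierLevel j ≤ barrier j x})

lemma isClosed_before (c : ℕ) (δ : ℝ) (j : ℕ) : IsClosed (before c δ j) :=
  ((Set.finite_Iio j).isClosed_biUnion fun _ _ => isClosed_hall _ _ _).union <|
    (isClosed_hall _ _ _).inter <| isClosed_le (continuous_barrier j) continuous_const

lemma isClosed_beyond (c : ℕ) (δ : ℝ) (j : ℕ) : IsClosed (beyond c δ j) :=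
  ((Set.finite_Ioc j c).isClosed_biUnion fun _ _ => isClosed_hall _ _ _).union <|
    (isClosed_hall _ _ _).inter <| isClosed_le continuous_const (continuous_barrier j)

lemma spiralPolyhedron_subset {c : ℕ} (hc : 1 ≤ c) {δ : ℝ} (j : ℕ) :
    spiralPolyhedron c δ ⊆ before c δ j ∪ beyond c δ j := by
  intro x hx
  obtain ⟨i, hic, hi⟩ := (mem_spiralPolyhedron hc).1 hx
  rcases lt_trichotomy i j with h | rfl | h
  · exact .inl (.inl (Set.mem_biUnion h hi))
  · rcases le_total (barrier i x) (barrierLevel i) with h | h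
    · exact .inl (.inr ⟨hi, h⟩)
    · exact .inr (.inr ⟨hi, h⟩)
  · exact .inr (.inl (Set.mem_biUnion ⟨h, hic⟩ hi))

lemma before_mono {c : ℕ} {δ : ℝ} : Monotone (before c δ) := by
  refine monotone_nat_of_le_succ fun j x hx => .inl ?_
  rcases hx with hx | hx
  · obtain ⟨i, hi, hx⟩ := Set.mem_iUnion₂.1 hx
    exact Set.mem_biUnion (Set.mem_Iio.2 ((Set.mem_Iio.1 hi).trans j.lt_succ_self)) hx
  · exact Set.mem_biUnion (Set.mem_Iio.2 j.lt_succ_self) hx.1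

lemma mem_barrier {c : ℕ} {δ : ℝ} (hδ₀ : 0 < δ) (hδ₁ : δ < 1) {j : ℕ}
    {x : EuclideanSpace ℝ (Fin 3)} (h : x ∈ before c δ j) (h' : x ∈ beyond c δ j) :
    x ∈ hall c δ j ∧ barrier j x = barrierLevel j := by
  rcases h with h | h <;> rcases h' with h' | h'
  · obtain ⟨i, hi, hx⟩ := Set.mem_iUnion₂.1 h
    obtain ⟨i', hi', hx'⟩ := Set.mem_iUnion₂.1 h'
    simp only [Set.mem_Iio, Set.mem_Ioc] at hi hi'
    have := (inSector_of_mem_hall hδ₀ hx).eq_succ_of_lt hδ₀ hδ₁ (by omega)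
      (inSector_of_mem_hall hδ₀ hx')
    omega
  · obtain ⟨i, hi, hx⟩ := Set.mem_iUnion₂.1 h
    have hj := inSector_of_mem_hall hδ₀ h'.1
    obtain ⟨rfl, hA⟩ := (inSector_of_mem_hall hδ₀ hx).eq_succ_of_lt hδ₀ hδ₁ hi hj
    exact absurd h'.2 (barrier_lt_level (by omega) hj (by rw [coordB_succ, hA, neg_zero])).not_ge
  · obtain ⟨i, hi, hx⟩ := Set.mem_iUnion₂.1 h'
    have hA := ((inSector_of_mem_hall hδ₀ h.1).eq_succ_of_lt hδ₀ hδ₁ hi.1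
      (inSector_of_mem_hall hδ₀ hx)).2
    exact absurd h.2 (level_lt_barrier hδ₀ h.1 hA).not_ge
  · exact ⟨h.1, le_antisymm h.2 h'.2⟩

/-- Near the barrier, the polyhedron agrees with the hallway. -/
lemma eventually_mem_hall {c : ℕ} (hc : 1 ≤ c) {δ : ℝ} (hδ₀ : 0 < δ) (hδ₁ : δ < 1) {j : ℕ}
    {x : EuclideanSpace ℝ (Fin 3)} (hx : x ∈ hall c δ j) (hb : barrier j x = barrierLevel j) :
    ∀ᶠ y in nhds x, y ∈ spiralPolyhedron c δ → y ∈ hall c δ j := by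
  have hclosed : IsClosed (⋃ i ∈ {i | i ≤ c ∧ i ≠ j}, hall c δ i) :=
    ((Set.finite_Iic c).subset fun _ h => h.1).isClosed_biUnion fun _ _ => isClosed_hall _ _ _
  have hnot : x ∉ ⋃ i ∈ {i | i ≤ c ∧ i ≠ j}, hall c δ i := by
    intro h
    obtain ⟨i, ⟨-, hij⟩, hi⟩ := Set.mem_iUnion₂.1 h
    have hsj := inSector_of_mem_hall hδ₀ hx
    have hsi := inSector_of_mem_hall hδ₀ hi
    rcases hij.lt_or_gt with h | h
    · obtain ⟨rfl, hA⟩ := hsi.eq_succ_of_lt hδ₀ hδ₁ h hsj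
      exact (barrier_lt_level (by omega) hsj (by rw [coordB_succ, hA, neg_zero])).ne hb
    · exact (level_lt_barrier hδ₀ hx (hsj.eq_succ_of_lt hδ₀ hδ₁ h hsi).2).ne hb.symm
  filter_upwards [hclosed.isOpen_compl.mem_nhds hnot] with y hy hyP
  obtain ⟨i, hic, hi⟩ := (mem_spiralPolyhedron hc).1 hyP
  by_contra hyj
  exact hy (Set.mem_biUnion ⟨hic, fun h => hyj (h ▸ hi)⟩ hi)

/-- It is possible to move backwards in a hallway. -/
lemma exists_backward {c : ℕ} {δ : ℝ} (hδ : 0 < δ) {j : ℕ} (hjc : j < c)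
    {x : EuclideanSpace ℝ (Fin 3)} (hx : x ∈ hall c δ j) (hb : barrier j x = barrierLevel j) :
    ∃ ε : ℝ, 0 < ε ∧ x + ε • (-barrierNormal j x) ∈ hall c δ j := by
  by_cases hj : j = 0
  · subst hj
    refine ⟨1, one_pos, ?_⟩
    rw [barrierNormal, if_pos rfl, one_smul, hall_zero, neg_sub, add_sub_cancel]
    exact subset_convexHull ℝ _ ⟨3, by simp [spiralTet]⟩
  · have hs := inSector_of_mem_hall hδ hx
    have hB : 0 < coordB j x := hs.coordB_nonneg.lt_of_ne fun h0 =>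
      (barrier_lt_level hj hs h0.symm).ne hb
    have h0 := spiralRadius_pos j
    have h1 := spiralRadius_pos (j + 1)
    have h0' : 0 < spiralRadius j + δ := by positivity
    have h1' : 0 < spiralRadius (j + 1) + δ := by positivity
    have h01 := spiralRadius_mono j.le_succ
    rw [hall_eq hδ hj hjc] at hx ⊢
    obtain ⟨hA, -, hZ, hI, hU, hO⟩ := hx
    -- Go back parallel to the inner wall until the entrance face `coordB j = 0`. The inner gauge is
    -- unchanged, and the outer one does not increase because the radii are monotone.
    set ε := coordB j x / spiralRadius (j + 1) with hε
    have hε0 : 0 < ε := by positivity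
    refine ⟨ε, hε0, ?_⟩
    rw [barrierNormal, if_neg hj]
    set y := x + ε • -(spiralR (j + 1) - spiralR j) with hy
    have hyA : coordA j y = coordA j x + ε * spiralRadius j := by simp [hy]
    have hyB : coordB j y = coordB j x - ε * spiralRadius (j + 1) := by simp [hy]; ring
    have hyZ : height y = height x := by simp [hy]
    have hyG : gauge j (spiralRadius j) (spiralRadius (j + 1)) y =
        gauge j (spiralRadius j) (spiralRadius (j + 1)) x := by
      rw [gauge_apply, gauge_apply, hyA, hyB]; field_simp; ring
    have hyO : gauge j (spiralRadius j + δ) (spiralRadius (j + 1) + δ) y ≤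
        gauge j (spiralRadius j + δ) (spiralRadius (j + 1) + δ) x := by
      have : spiralRadius j / (spiralRadius j + δ) ≤
          spiralRadius (j + 1) / (spiralRadius (j + 1) + δ) := by
        rw [div_le_div_iff₀ h0' h1']; nlinarith
      have := mul_le_mul_of_nonneg_left this hε0.le
      rw [gauge_apply, gauge_apply, hyA, hyB, add_div, sub_div, mul_div_assoc, mul_div_assoc]
      linarith
    refine ⟨?_, ?_, ?_, ?_, ?_, ?_⟩
    · rw [hyA]; positivity
    · rw [hyB, hε, div_mul_cancel₀ _ h1.ne', sub_self]
    · rwa [hyZ]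
    · rwa [hyG]
    · rwa [hyG, hyZ]
    · rw [hyZ]; linarith

/-- The condition on a beacon that attracts a point across the barrier in hallway `j`. -/
def Pulls (c : ℕ) (δ : ℝ) (j : ℕ) (b : EuclideanSpace ℝ (Fin 3)) : Prop :=
  ∃ x ∈ hall c δ j, barrier j x = barrierLevel j ∧ 0 ≤ inner ℝ (barrierNormal j x) (b - x)

lemma Covers.pulls {c : ℕ} (hc : 1 ≤ c) {δ : ℝ} (hδ₀ : 0 < δ) (hδ₁ : δ < 1) {j : ℕ} (hjc : j < c)
    {p b : EuclideanSpace ℝ (Fin 3)} (h : Covers (spiralPolyhedron c δ) b p)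
    (hp : p ∈ before c δ j) (hb : b ∉ before c δ j) : Pulls c δ j b := by
  obtain ⟨T, γ, hγ⟩ := h
  obtain ⟨t₀, ht₀, hL, hU, hlast⟩ := hγ.exists_last (isClosed_before c δ j)
    (isClosed_beyond c δ j) (spiralPolyhedron_subset hc j) hp hb
  obtain ⟨hx, hlevel⟩ := mem_barrier hδ₀ hδ₁ hL hU
  refine ⟨γ t₀, hx, hlevel, ?_⟩
  by_contra! hneg
  obtain ⟨v, hv, hderiv⟩ := hγ.greedy t₀ ht₀
  have hloc := eventually_mem_hall hc hδ₀ hδ₁ hx hlevel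
  obtain ⟨ε, hε, hback⟩ := exists_backward hδ₀ hjc hx hlevel
  have hpos := hv.inner_pos (fun y hy => (mem_spiralPolyhedron hc).2 ⟨j, hjc.le, hy⟩)
    (convex_hall hδ₀ hjc) (hv.feasible.of_eventually hloc) hε hback
    (by rw [inner_neg_left]; linarith)
  have hd := (hasFDerivAt_barrier j (γ t₀)).comp_hasDerivWithinAt t₀ hderiv
  have hnonneg := nonneg_of_hasDerivWithinAt_Ici hd (by
    have hcont : Filter.Tendsto γ (nhdsWithin t₀ (Set.Ioi t₀)) (nhds (γ t₀)) :=
      hderiv.continuousWithinAt.mono_left (nhdsWithin_mono _ Set.Ioi_subset_Ici_self)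
    filter_upwards [hcont.eventually hloc, Ioc_mem_nhdsGT ht₀.2] with t ht ht'
    have hmem := ht (hγ.mem t ⟨ht₀.1.trans ht'.1.le, ht'.2⟩)
    by_contra! hlt
    exact hlast t ht' (.inr ⟨hmem, hlt.le.trans hlevel.le⟩))
  rw [innerSL_apply_apply] at hnonneg
  rw [inner_neg_left] at hpos
  linarith

/-! ### Barriers cannot be crossed together -/

/-- A plane barrier has constant normal, so the condition on `x` only says that `b` is on or past
the plane. -/
lemma Pulls.level_le {c : ℕ} {δ : ℝ} {j : ℕ} (hj : j ≠ 0) {b : EuclideanSpace ℝ (Fin 3)}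
    (h : Pulls c δ j b) : barrierLevel j ≤
      coordB j b * (spiralRadius (j + 1) + spiralRadius j / 2) -
      coordA j b * (spiralRadius (j + 1) / 2 + spiralRadius j) := by
  obtain ⟨x, -, hlevel, hb⟩ := h
  rw [barrierNormal, if_neg hj, inner_sub_right, sub_nonneg] at hb
  rwa [← inner_spiralR_sub, ← hlevel, barrier, if_neg hj]

lemma not_pulls_zero {c : ℕ} {δ : ℝ} (hδ₀ : 0 < δ) (hδ₁ : δ < 1) {b : EuclideanSpace ℝ (Fin 3)}
    (hb : height b ≤ 1) (h1 : coordB 0 b - coordA 0 b ≤ 5 / 9)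
    (h2 : coordB 0 b - coordA 0 b / 2 ≤ 1 / 2) : ¬ Pulls c δ 0 b := by
  rintro ⟨x, hx, hlevel, h⟩
  have hs := inSector_of_mem_hall hδ₀ hx
  have hwall := start_wall hδ₀ hx
  have hA := hs.coordA_nonneg
  have hB := hs.coordB_nonneg
  have hZ := hs.height_nonneg
  have hG := hs.inner_wall
  simp only [gauge_apply, zero_add, spiralRadius_zero, spiralRadius_one, div_one] at hG
  rw [inner_sub_right, barrierNormal, if_pos rfl] at h
  rw [barrierLevel, if_pos rfl, barrier_zero] at hlevel
  have e : inner ℝ (x - spiralR 0) b - inner ℝ (x - spiralR 0) x =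
      inner ℝ (x - spiralR 0) (b - spiralR 0) - inner ℝ (x - spiralR 0) (x - spiralR 0) := by
    simp only [inner_sub_right]; ring
  rw [e, inner_eq_coord, inner_eq_coord (x - spiralR 0) (x - spiralR 0)] at h
  simp [spiralRadius_zero] at h
  obtain ⟨p, hp⟩ : ∃ p, p = 1 - coordA 0 x := ⟨_, rfl⟩
  obtain ⟨m, hm⟩ : ∃ m, m = coordB 0 x - p := ⟨_, rfl⟩
  have hAx : coordA 0 x = 1 - p := by linarith
  have hBx : coordB 0 x = p + m := by linarith
  rw [hAx, hBx] at h hwall hlevel hG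
  have hm0 : 0 ≤ m := by linarith
  generalize height x = Z at *
  generalize height b = Z' at *
  have hmZ : m + δ * Z ≤ δ * p := by linarith
  have hp0 : 0 ≤ p := by
    by_contra! hneg
    nlinarith [mul_nonneg hδ₀.le hZ]
  have hmp : m ≤ p := by nlinarith [mul_nonneg hδ₀.le hZ]
  have hZp : Z ≤ p := by
    refine le_of_mul_le_mul_left ?_ hδ₀
    linarith
  have hquad : 3 * p ^ 2 + 3 * p * m + m ^ 2 + Z ^ 2 = 29 / 10 := by linarith
  -- `⟪x - s, b - s⟫ = 3/2 * p * (B - A + 1) + m * (B - A/2 + 1/2) + Z * Z'`, where `A`, `B` are the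
  -- coordinates of `b`; the bound `5 / 9` gives `3/2 * 14/9 = 7/3`.
  have hlin : 29 / 10 ≤ 7 / 3 * p + m + Z := by
    have k1 : p * (coordB 0 b - coordA 0 b) ≤ p * (5 / 9) := by gcongr
    have k2 : m * (coordB 0 b - coordA 0 b / 2) ≤ m * (1 / 2) := by gcongr
    have k3 : Z * Z' ≤ Z * 1 := by gcongr
    linarith
  have hsq : (29 / 10) ^ 2 ≤ (7 / 3 * p + m + Z) ^ 2 := by gcongr
  have hp1 : 0 < p := by
    rcases hp0.eq_or_lt with h0 | h0
    · nlinarith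
    · exact h0
  -- On the cone `0 ≤ m ≤ p`, `0 ≤ Z ≤ p` with `p > 0`, `(7/3 * p + m + Z)^2` is less than `29/10`
  -- times the quadratic form of `hquad`; on the ray `m = 0`, `Z = p` this reads `100/9 < 58/5`.
  nlinarith [mul_nonneg hp0 hm0, mul_nonneg hm0 (sub_nonneg.2 hZp), mul_nonneg hZ (sub_nonneg.2 hZp),
    mul_nonneg hp0 hZ, mul_nonneg hp0 (sub_nonneg.2 hZp), mul_pos hp1 hp1]

lemma InSector.one_le_add {δ : ℝ} {j : ℕ} {x : EuclideanSpace ℝ (Fin 3)} (h : InSector δ j x) :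
    1 ≤ coordA j x + coordB j x := by
  have hI := h.inner_wall
  rw [gauge_apply] at hI
  have h1 := div_le_self h.coordA_nonneg (one_le_spiralRadius j)
  have h2 := div_le_self h.coordB_nonneg (one_le_spiralRadius (j + 1))
  linarith

/-- Points in the second next sector do not attract across a barrier. -/
lemma not_pulls_of_inSector {c : ℕ} {δ : ℝ} (hδ₀ : 0 < δ) (hδ₁ : δ < 1) {j m : ℕ}
    {b : EuclideanSpace ℝ (Fin 3)} (hb : InSector δ (j + 2 + 3 * m) b) : ¬ Pulls c δ j b := by
  have hA := hb.coordA_nonneg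
  have hB := hb.coordB_nonneg
  have hAB := hb.one_le_add
  rw [coordA_add_three_mul, coordA_add_two] at hA hAB
  rw [coordB_add_three_mul, coordB_add_two] at hB hAB
  by_cases hj : j = 0
  · subst hj
    exact not_pulls_zero hδ₀ hδ₁ hb.height_le (by linarith) (by linarith)
  · intro h
    have hl := h.level_le hj
    have hpos := barrierLevel_pos j
    have h0 := spiralRadius_pos j
    have h01 := spiralRadius_mono j.le_succ
    have k1 : 0 ≤ (coordA j b - coordB j b) * (spiralRadius (j + 1) / 2 + spiralRadius j) :=
      mul_nonneg hB (by linarith [h01.trans' h0.le])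
    have k2 : 0 ≤ -coordB j b * (spiralRadius (j + 1) - spiralRadius j) :=
      mul_nonneg hA (sub_nonneg.2 h01)
    linarith

/-- In the frame of hallway `j + 1`, pulling across barrier `j` makes `coordA` large and pulling
across barrier `j + 1` makes `coordB` large; for `j ≠ 0` this puts `b` outside the outer wall. For
`j = 0`, the second pull and the outer wall give `coordA 1 b ≤ 11/20 < 5/9`, as `not_pulls_zero`
requires. -/
lemma not_pulls_and_pulls {c : ℕ} {δ : ℝ} (hδ₀ : 0 < δ) (hδ₁ : δ < 1) {j : ℕ}
    {b : EuclideanSpace ℝ (Fin 3)} (hb : InSector δ (j + 1) b) (h' : Pulls c δ (j + 1) b) :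
    ¬ Pulls c δ j b := by
  have hA := hb.coordA_nonneg
  have hB := hb.coordB_nonneg
  have hO := hb.outer_wall
  have hj1 : j + 1 ≠ 0 := j.succ_ne_zero
  have hl' := h'.level_le hj1
  have ha := one_le_spiralRadius j
  have ha1 := one_le_spiralRadius (j + 1)
  have h01 := spiralRadius_mono j.le_succ
  have h12 := spiralRadius_mono (j + 1).le_succ
  have h12' := spiralRadius_succ_le (j + 1)
  have hp := spiralRadius_pos j
  have hp1 := spiralRadius_pos (j + 1)
  have hp2 := spiralRadius_pos (j + 1 + 1)
  rw [gauge_apply, div_add_div _ _ (by positivity) (by positivity),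
    div_le_one (by positivity)] at hO
  rw [barrierLevel, if_neg hj1] at hl'
  by_cases hj : j = 0
  · subst hj
    have hA' := coordA_succ 0 b
    have hB' := coordB_succ 0 b
    simp only [zero_add, Nat.reduceAdd, spiralRadius_one, spiralRadius_two] at *
    have hO' : coordA 1 b + coordB 1 b ≤ 1 + δ := by
      refine le_of_mul_le_mul_right (a := 1 + δ) ?_ (by positivity)
      linarith
    exact not_pulls_zero hδ₀ hδ₁ hb.height_le (by linarith) (by linarith)
  · intro h
    have hl := h.level_le hj
    rw [barrierLevel, if_neg hj] at hl
    have hA' := coordA_succ j b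
    have hB' := coordB_succ j b
    have eA : coordA j b = -coordB (j + 1) b := by linarith
    have eB : coordB j b = coordA (j + 1) b - coordB (j + 1) b := by linarith
    rw [eA, eB] at hl
    simp only [show j + 1 + 1 = j + 2 from rfl, Nat.succ_eq_add_one] at *
    generalize coordA (j + 1) b = A at *
    generalize coordB (j + 1) b = B at *
    generalize spiralRadius j = a₀ at *
    generalize spiralRadius (j + 1) = a at *
    generalize spiralRadius (j + 2) = a' at *
    have hAa : 9 / 10 * a ≤ A := by
      refine le_of_mul_le_mul_right (a := a + a₀ / 2) ?_ (by positivity)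
      nlinarith [mul_nonneg hB (sub_nonneg.2 h01)]
    have hBa : 9 / 10 * (a' + a * (2 / 3)) ≤ B := by
      refine le_of_mul_le_mul_right (a := a' + a / 2) ?_ (by positivity)
      have k1 : 9 / 10 * a * (a' / 2 + a) ≤ A * (a' / 2 + a) := by gcongr
      have k2 : 2 / 3 * (a' + a / 2) ≤ a' / 2 + a := by linarith
      nlinarith [mul_le_mul_of_nonneg_left k2 (by positivity : (0 : ℝ) ≤ 9 / 10 * a)]
    have k1 : 9 / 10 * a * (a' + δ) ≤ A * (a' + δ) := by gcongr
    have k2 : (a + δ) * (9 / 10 * (a' + a * (2 / 3))) ≤ (a + δ) * B := by gcongr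
    nlinarith

/-- No beacon attracts a point across two barriers. -/
lemma Covers.mem_before_succ {c : ℕ} (hc : 1 ≤ c) {δ : ℝ} (hδ₀ : 0 < δ) (hδ₁ : δ < 1) {j : ℕ}
    (hjc : j + 1 < c) {p b : EuclideanSpace ℝ (Fin 3)} (h : Covers (spiralPolyhedron c δ) b p)
    (hp : p ∈ before c δ j) : b ∈ before c δ (j + 1) := by
  by_contra hb
  have hbP : b ∈ spiralPolyhedron c δ := by
    obtain ⟨T, γ, hγ⟩ := h
    exact hγ.finish ▸ hγ.mem T ⟨hγ.nonneg, le_rfl⟩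
  have hpulls : ∀ k, j ≤ k → k < c → b ∉ before c δ k → Pulls c δ k b := fun k hk hkc hbk =>
    h.pulls hc hδ₀ hδ₁ hkc (before_mono hk hp) hbk
  have h0 := hpulls j le_rfl (by omega) fun h => hb (before_mono j.le_succ h)
  have h1 := hpulls (j + 1) j.le_succ hjc hb
  obtain ⟨i, hic, hi⟩ := (mem_spiralPolyhedron hc).1 hbP
  have hs := inSector_of_mem_hall hδ₀ hi
  have hij : j + 1 ≤ i := by
    by_contra! hlt
    exact hb (.inl (Set.mem_biUnion (Set.mem_Iio.2 hlt) hi))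
  -- Unless `b` lies in hallway `j + 1` itself, its sector is of the form `k + 2 + 3 * m` for one of
  -- the barriers `k = j`, `j + 1`, `j + 2` that have been crossed.
  obtain ⟨m, rfl | rfl | rfl⟩ := exists_eq_add_three_mul hij
  · rcases m with _ | m
    · exact not_pulls_and_pulls hδ₀ hδ₁ hs h1 h0
    · refine not_pulls_of_inSector (j := j + 2) (m := m) hδ₀ hδ₁
        (by convert hs using 1; ring) (hpulls (j + 2) (by omega) (by omega) fun h2 => ?_)
      have : ∃ i ≤ j + 2, b ∈ hall c δ i := by
        rcases h2 with h2 | h2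
        · obtain ⟨i, hi, hbi⟩ := Set.mem_iUnion₂.1 h2
          exact ⟨i, (Set.mem_Iio.1 hi).le, hbi⟩
        · exact ⟨_, le_rfl, h2.1⟩
      obtain ⟨i, hij, hbi⟩ := this
      have := (inSector_of_mem_hall hδ₀ hbi).eq_succ_of_lt hδ₀ hδ₁ (by omega) hs
      omega
  · exact not_pulls_of_inSector hδ₀ hδ₁ (m := m) (by convert hs using 1) h0
  · exact not_pulls_of_inSector hδ₀ hδ₁ (m := m) (by convert hs using 1) h1

/-! ### The lower bound -/

lemma exists_step_of_isChain {α : Type*} {R : α → α → Prop} {L : Set α} {y : α} :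
    ∀ {l : List α} {x : α}, List.IsChain R (x :: l) → x ∈ L → y ∈ l → y ∉ L →
      ∃ p b, b ∈ l ∧ R p b ∧ p ∈ L ∧ b ∉ L
  | [], _, _, _, hy, _ => absurd hy List.not_mem_nil
  | z :: l, x, h, hx, hy, hyL => by
    rw [List.isChain_cons_cons] at h
    by_cases hz : z ∈ L
    · have hy' : y ∈ l := (List.mem_cons.1 hy).resolve_left fun h0 => hyL (h0 ▸ hz)
      obtain ⟨p, b, hb, hpb⟩ := exists_step_of_isChain h.2 hz hy' hyL
      exact ⟨p, b, List.mem_cons_of_mem _ hb, hpb⟩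
    · exact ⟨x, z, List.mem_cons_self, h.1, hx, hz⟩

lemma spiralS_mem_before (c : ℕ) (δ : ℝ) (j : ℕ) : spiralS ∈ before c δ j := by
  refine before_mono j.zero_le (.inr ⟨?_, ?_⟩)
  · rw [hall_zero, spiralS_eq]
    exact subset_convexHull ℝ _ ⟨3, by simp [spiralTet]⟩
  · simp [spiralS_eq, barrier, barrierLevel]
    norm_num

/-- Sector `c + 1` contains no part of the polyhedron's hallways by definition, but sectors exist
for every index, and `t = r_{c+1}` is also a corner of this one. -/
lemma inSector_spiralT (c : ℕ) {δ : ℝ} (hδ : 0 < δ) : InSector δ (c + 1) (spiralT c) := by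
  have := inSector_spiralTet hδ (c + 1) 0 0
  rwa [spiralTet, if_neg c.succ_ne_zero, ← spiralT_eq] at this

lemma spiralT_notMem_before {c : ℕ} {δ : ℝ} (hδ₀ : 0 < δ) (hδ₁ : δ < 1) {j : ℕ} (hj : j < c) :
    spiralT c ∉ before c δ j := by
  intro h
  have : ∃ i ≤ j, spiralT c ∈ hall c δ i := by
    rcases h with h | h
    · obtain ⟨i, hi, hbi⟩ := Set.mem_iUnion₂.1 h
      exact ⟨i, (Set.mem_Iio.1 hi).le, hbi⟩
    · exact ⟨_, le_rfl, h.1⟩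
  obtain ⟨i, hi, h⟩ := this
  have := (inSector_of_mem_hall hδ₀ h).eq_succ_of_lt hδ₀ hδ₁ (by omega) (inSector_spiralT c hδ₀)
  omega

lemma card_beacons {c : ℕ} (hc : 1 ≤ c) {δ : ℝ} (hδ₀ : 0 < δ) (hδ₁ : δ < 1)
    (B : Finset (EuclideanSpace ℝ (Fin 3)))
    (h : RoutableVia (spiralPolyhedron c δ) B spiralS (spiralT c)) : c ≤ B.card := by
  obtain ⟨l, hl, hchain⟩ := h
  have hstep : ∀ j, ∃ p b, j < c → b ∈ l ++ [spiralT c] ∧ Covers (spiralPolyhedron c δ) b p ∧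
      p ∈ before c δ j ∧ b ∉ before c δ j := by
    intro j
    by_cases hj : j < c
    · obtain ⟨p, b, hpb⟩ := exists_step_of_isChain hchain (spiralS_mem_before c δ j)
        (y := spiralT c) (by simp) (spiralT_notMem_before hδ₀ hδ₁ hj)
      exact ⟨p, b, fun _ => hpb⟩
    · exact ⟨0, 0, fun h => absurd h hj⟩
  choose p b hpb using hstep
  rw [← Finset.card_range c]
  refine Finset.card_le_card_of_injOn b (fun j hj => ?_) ?_
  · have hj' : j < c := Finset.mem_range.1 hj
    obtain ⟨hmem, hcov, hp, -⟩ := hpb j hj'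
    rcases List.mem_append.1 hmem with hmem | hmem
    · exact hl _ hmem
    · rw [List.mem_singleton.1 hmem] at hcov
      -- If `t` itself were the crossing beacon, it would also pull across the last barrier `c - 1`;
      -- but `t` lies in sector `(c - 1) + 2`.
      have hpull := hcov.pulls hc hδ₀ hδ₁ (j := c - 1) (by omega) (before_mono (by omega) hp)
        (spiralT_notMem_before hδ₀ hδ₁ (by omega))
      refine absurd hpull (not_pulls_of_inSector hδ₀ hδ₁ (m := 0) ?_)
      rw [show c - 1 + 2 + 3 * 0 = c + 1 by omega]
      exact inSector_spiralT c hδ₀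
  -- The beacon crossing barrier `i` lies before barrier `i + 1`, hence before barrier `j`, whereas
  -- `b j` does not.
  · have key : ∀ i j, i < j → j < c → b i ≠ b j := fun i j hij hj hb => by
      obtain ⟨-, hcov, hp, -⟩ := hpb i (hij.trans hj)
      exact (hpb j hj).2.2.2 (hb ▸ before_mono hij
        (hcov.mem_before_succ hc hδ₀ hδ₁ (by omega) hp))
    intro i hi j hj hb
    have hi' : i < c := Finset.mem_range.1 hi
    have hj' : j < c := Finset.mem_range.1 hj
    rcases lt_trichotomy i j with h | h | h
    · exact absurd hb (key i j h hj')
    · exact h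
    · exact absurd hb.symm (key j i h hi')

end

end Beacon

theorem mainTheorem3 (c : ℕ) (hc : 1 ≤ c) (δ : ℝ) (hδ₀ : 0 < δ) (hδ₁ : δ < 1) :
    (Beacon.spiralVertices c δ).ncard = 3 * c + 2 ∧
    Beacon.IsTetrahedralDecomposition (Beacon.spiralPolyhedron c δ) (Beacon.spiralTetrahedra c δ) ∧
    (Beacon.spiralTetrahedra c δ).ncard = 3 * c - 1 ∧
    ∀ B : Finset (EuclideanSpace ℝ (Fin 3)),
      (∀ b ∈ B, b ∈ Beacon.spiralPolyhedron c δ) →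
      Beacon.RoutableVia (Beacon.spiralPolyhedron c δ) B Beacon.spiralS (Beacon.spiralT c) →
      c ≤ B.card :=
  ⟨Beacon.ncard_spiralVertices c hc hδ₀ hδ₁,
    Beacon.isTetrahedralDecomposition_spiralPolyhedron c hc hδ₀ hδ₁,
    Beacon.ncard_spiralTetrahedra c hc hδ₀ hδ₁,
    fun B _ h => Beacon.card_beacons hc hδ₀ hδ₁ B h⟩
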